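/- Let $|k\rangle$, $k\in\mathbb N=\{0,1,2,\dots\}$, be the Fock basis of the Hilbert space $\mathcal H$ of a single bosonic mode, and for $\alpha\in\mathbb C$ let $$|\alpha\rangle = e^{-|\alpha|^2/2}\sum_{k=0}^\infty \frac{\alpha^k}{\sqrt{k!}}\,|k\rangle$$ be the corresponding coherent state. A measure-and-prepare channel is a map $\Lambda(X)=\sum_\ell \operatorname{Tr}[X E_\ell]\,\rho_\ell$, where $(E_\ell)_\ell$ is a discrete POVM on $\mathcal H$ (finitely or countably many positive bounded operators that sum weakly to $\mathbb 1$) and the $\rho_\ell$ are density operators on $\mathcal H$. For a probability measure $p$ on $\mathbb C$, let $$F_{c\ell}(p)=\sup_{\Lambda}\int_{\mathbb C} \operatorname{Tr}\big[\Lambda(|\alpha\rangle\langle\alpha|)\,|\alpha\rangle\langle\alpha|\big]\,dp(\alpha),$$ where the supremum is over all measure-and-prepare channels $\Lambda$; this is the classical fidelity for teleporting coherent states distributed according to $p$. (1) Let $p$ be a probability measure on $\mathbb C$ that is phase-invariant, i.e. invariant under $\alpha\mapsto e^{i\varphi}\alpha$ for all $\varphi\in\mathbb R$. Then $$F_{c\ell}(p)\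 \le\ \inf_q\ \sup_{N\in\mathbb N}\ \mu_N\sum_{k=0}^N\frac{1}{q_k}\binom Nk\ \le\ \sup_{N\in\mathbb N}\ \mu_N\sum_{k=0}^N\frac1{\nu_k}\binom Nk ,$$ where the infimum is over all probability distributions $q$ on $\mathbb N$, $$\mu_N=\frac1{N!}\int_{\mathbb C} e^{-2|\alpha|^2}|\alpha|^{2N}\,dp(\alpha),\qquad \nu_k=\frac1{k!}\int_{\mathbb C} e^{-|\alpha|^2}|\alpha|^{2k}\,dp(\alpha),$$ and the expressions take values in $[0,\infty]$ with $1/0=\infty$ and $0\cdot\infty=0$. (2) In particular, for $\lambda>0$ let $p_\lambda$ be the probability measure with density $\frac\lambda\pi e^{-\lambda|\alpha|^2}$ with respect to Lebesgue measure $d^2\alpha$ on $\mathbb C$. It is phase-invariant, both upper bounds in (1) are equal to $\frac{1+\lambda}{2+\lambda}$, and they are attained: $$F_{c\ell}(p_\lambda)=\frac{1+\lambda}{2+\lambda}.$$ -/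

import Mathlib

open MeasureTheory
open scoped ENNReal

noncomputable section

namespace CoherentTeleportation

/-- The Hilbert space of a single bosonic mode, in its Fock representation `ℓ²(ℕ)`. -/
abbrev FockSpace : Type := lp (fun _ : ℕ => ℂ) 2

/-- Bounded operators on the Fock space. -/
abbrev Operator : Type := FockSpace →L[ℂ] FockSpace

/-- The Fock state `|k⟩`. -/
def fock (k : ℕ) : FockSpace := lp.single 2 k (1 : ℂ)

/-- The coefficient `e^{-|α|²/2} α^k / √(k!)` of `|k⟩` in the coherent state `|α⟩`. -/
def coherentCoeff (α : ℂ) (k : ℕ) : ℂ :=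
  (Real.exp (-‖α‖ ^ 2 / 2) : ℂ) * (α ^ k / (Real.sqrt (k.factorial : ℝ) : ℂ))

theorem memlp_coherentCoeff (α : ℂ) : Memℓp (coherentCoeff α) 2 := by
  apply memℓp_gen
  have h := (Real.summable_pow_div_factorial (‖α‖ ^ 2)).mul_left
    (Real.exp (-‖α‖ ^ 2 / 2) ^ 2)
  refine h.congr fun k => ?_
  have hk : (0 : ℝ) ≤ (k.factorial : ℝ) := by positivity
  simp only [coherentCoeff, norm_mul, norm_div, norm_pow, Complex.norm_real, Real.norm_eq_abs,
    ENNReal.toReal_ofNat, Real.rpow_two, mul_pow, div_pow, sq_abs, Real.sq_sqrt hk]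
  ring

/-- The coherent state `|α⟩ = e^{-|α|²/2} ∑ₖ α^k / √(k!) |k⟩`. -/
def coherent (α : ℂ) : FockSpace := ⟨coherentCoeff α, memlp_coherentCoeff α⟩

/-- The rank-one operator `|ψ⟩⟨ψ|`. -/
def pureState (ψ : FockSpace) : Operator := InnerProductSpace.rankOne ℂ ψ ψ

/-- The trace, computed in the Fock basis. -/
def trace (T : Operator) : ℂ := ∑' k : ℕ, inner ℂ (fock k) (T (fock k))

/-- Density operators: positive operators of finite trace, with trace one. -/
structure IsState (ρ : Operator) : Prop where
  isPositive : ρ.IsPositive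
  hasSum_trace : HasSum (fun k : ℕ => inner ℂ (fock k) (ρ (fock k))) (1 : ℂ)

/-- Discrete POVMs, indexed by `ℕ` (a finite POVM is padded with zeros): positive operators
that sum to the identity in the weak operator topology. -/
structure IsPOVM (E : ℕ → Operator) : Prop where
  isPositive : ∀ l, (E l).IsPositive
  hasSum_one : ∀ x y : FockSpace, HasSum (fun l => inner ℂ x (E l y)) (inner ℂ x y)

/-- The data of a measure-and-prepare channel: a discrete POVM, and a state to be prepared for
each outcome. -/
structure MeasurePrepare where
  effect : ℕ → Operator
  prepared : ℕ → Operator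
  isPOVM : IsPOVM effect
  isState : ∀ l, IsState (prepared l)

/-- The channel `Λ(X) = ∑ₗ Tr[X Eₗ] ρₗ`; for trace class `X` the series converges in norm. -/
def MeasurePrepare.channel (M : MeasurePrepare) (X : Operator) : Operator :=
  ∑' l : ℕ, trace (X * M.effect l) • M.prepared l

/-- The classical fidelity (classical threshold) for the ensemble of the pure states `ψ a`, with
`a` distributed according to `p`, and for the identity channel:
the supremum over all measure-and-prepare channels `Λ` of `∫ Tr[Λ(ψ_a) ψ_a] dp(a)`.
The integrand is a nonnegative real number. -/
def classicalFidelity {A : Type*} [MeasurableSpace A] (p : Measure A) (ψ : A → FockSpace) :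
    ℝ≥0∞ :=
  ⨆ M : MeasurePrepare,
    ∫⁻ a, ENNReal.ofReal (trace (M.channel (pureState (ψ a)) * pureState (ψ a))).re ∂p

/-- Invariance of a distribution on `ℂ` under all rotations `α ↦ e^{iφ} α`. -/
def PhaseInvariant (p : Measure ℂ) : Prop :=
  ∀ φ : ℝ, p.map (fun α : ℂ => Complex.exp (φ * Complex.I) * α) = p

/-- `μ_N = (1/N!) ∫ e^{-2|α|²} |α|^{2N} dp(α)`. -/
def mu (p : Measure ℂ) (N : ℕ) : ℝ :=
  1 / (N.factorial : ℝ) * ∫ α, Real.exp (-2 * ‖α‖ ^ 2) * ‖α‖ ^ (2 * N) ∂p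

/-- `ν_k = (1/k!) ∫ e^{-|α|²} |α|^{2k} dp(α)`. -/
def nu (p : Measure ℂ) (k : ℕ) : ℝ :=
  1 / (k.factorial : ℝ) * ∫ α, Real.exp (-‖α‖ ^ 2) * ‖α‖ ^ (2 * k) ∂p

/-- `sup_N μ_N ∑_{k ≤ N} binom(N,k) / q_k` in `[0,∞]`, with `1/0 = ∞` and `0 · ∞ = 0`. -/
def benchmark (p : Measure ℂ) (q : ℕ → ℝ≥0∞) : ℝ≥0∞ :=
  ⨆ N : ℕ, ENNReal.ofReal (mu p N) * ∑ k ∈ Finset.range (N + 1), (N.choose k : ℝ≥0∞) / q k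

/-- The Gaussian distribution with density `p_r(α) = (r/π) e^{-r|α|²}`. -/
def gaussian (r : ℝ) : Measure ℂ :=
  volume.withDensity fun α : ℂ => ENNReal.ofReal (r / Real.pi * Real.exp (-r * ‖α‖ ^ 2))

end CoherentTeleportation

end

noncomputable section

namespace CoherentTeleportation

open Filter Topology

/-! Upper bound. The fidelity of a measure-and-prepare channel is `∑ₗ ∫ ⟨α|Eₗ|α⟩⟨α|ρₗ|α⟩ dp`.
Splitting each positive quadratic form into squares of linear functionals reduces it to integrals of
`|⟨f|α⟩|² |⟨g|α⟩|²`. Up to the factor `e^{-2|α|²}`, the integrand is the squared modulus of a power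
series in `α` whose degree-`N` coefficient is `c_N = ∑_{k+l=N} f̄_k ḡ_l / √(k! l!)`. Phase
invariance makes distinct monomials orthogonal, leaving `∑_N N! μ_N |c_N|²`. Cauchy–Schwarz with
weights `q_k` bounds `N! |c_N|²` by `(∑_k binom(N,k)/q_k) ∑_{k+l=N} q_k |f_k|² |g_l|²`, and `μ_N`
times the first factor is at most the benchmark (`moment_mul_enorm_sum_sq_le`). What remains is
summed with `Tr ρₗ = 1`, `∑ₗ ⟨k|Eₗ|k⟩ = 1` and `∑ q_k = 1`. The second bound is the choice `q = ν`,
a `p`-average of Poisson distributions.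

Attainment. For the Gaussian prior with parameter `r`, the binomial theorem gives every `N` in the
benchmark with `q = ν` the same value `(1+r)/(2+r)`. Measuring `|β⟩⟨β| d²β/π` and preparing
`|β/(1+r)⟩` reaches that value by a Gaussian integral. This scheme has a continuum of outcomes, so
it is replaced by discrete schemes on growing windows, and Fatou's lemma passes to the limit
(`lintegral_heterodyne_le_classicalFidelity`). -/

/-! ### Fock coordinates, traces and positive operators -/

theorem enorm_conj (z : ℂ) : ‖(starRingEnd ℂ) z‖ₑ = ‖z‖ₑ := by
  rw [← ofReal_norm, RCLike.norm_conj, ofReal_norm]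

theorem inner_fock_left (k : ℕ) (x : FockSpace) : inner ℂ (fock k) x = x k := by
  simp [fock, lp.inner_single_left]

theorem inner_fock_right (k : ℕ) (x : FockSpace) :
    inner ℂ x (fock k) = (starRingEnd ℂ) (x k) := by
  rw [← inner_conj_symm, inner_fock_left]

theorem hasSum_inner_coord (x y : FockSpace) :
    HasSum (fun k => (starRingEnd ℂ) (x k) * y k) (inner ℂ x y) := by
  have h : (fun k => (starRingEnd ℂ) (x k) * y k) = fun k => inner ℂ (x k) (y k) :=
    funext fun k => (RCLike.inner_apply' (x k) (y k)).symm
  rw [h]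
  exact lp.hasSum_inner (𝕜 := ℂ) x y

theorem hasSum_sq_norm_coord (x : FockSpace) : HasSum (fun k => ‖x k‖ ^ 2) (‖x‖ ^ 2) := by
  have h := lp.hasSum_norm (p := 2) (by simp) x
  simpa using h

theorem tsum_enorm_sq_coord (x : FockSpace) : ∑' k, ‖x k‖ₑ ^ 2 = ‖x‖ₑ ^ 2 := by
  have h := hasSum_sq_norm_coord x
  have h2 := ENNReal.ofReal_tsum_of_nonneg (fun k => sq_nonneg ‖x k‖) h.summable
  rw [h.tsum_eq] at h2
  simp only [ENNReal.ofReal_pow (norm_nonneg _), ofReal_norm] at h2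
  exact h2.symm

theorem pureState_apply (ψ x : FockSpace) : pureState ψ x = inner ℂ ψ x • ψ := by
  simp [pureState]

theorem trace_mul_pureState (T : Operator) (ψ : FockSpace) :
    trace (T * pureState ψ) = inner ℂ ψ (T ψ) := by
  rw [← (hasSum_inner_coord ψ (T ψ)).tsum_eq]
  refine tsum_congr fun k => ?_
  change inner ℂ (fock k) (T (pureState ψ (fock k))) = _
  rw [pureState_apply, map_smul, inner_smul_right, inner_fock_left, inner_fock_right]

theorem trace_pureState_mul (T : Operator) (ψ : FockSpace) :
    trace (pureState ψ * T) = inner ℂ ψ (T ψ) := by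
  rw [← ContinuousLinearMap.adjoint_inner_left,
    ← (hasSum_inner_coord (ContinuousLinearMap.adjoint T ψ) ψ).tsum_eq]
  refine tsum_congr fun k => ?_
  change inner ℂ (fock k) (pureState ψ (T (fock k))) = _
  rw [pureState_apply, inner_smul_right, ← ContinuousLinearMap.adjoint_inner_left,
    inner_fock_left, inner_fock_right]

theorem exists_eq_adjoint_mul_self {H : Type*} [NormedAddCommGroup H] [InnerProductSpace ℂ H]
    [CompleteSpace H] {T : H →L[ℂ] H} (hT : T.IsPositive) :
    ∃ S : H →L[ℂ] H, T = ContinuousLinearMap.adjoint S * S := by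
  have h : 0 ≤ T := (ContinuousLinearMap.nonneg_iff_isPositive T).2 hT
  rw [CStarAlgebra.nonneg_iff_eq_star_mul_self] at h
  exact h

theorem inner_eq_ofReal_of_isPositive {T : Operator} (hT : T.IsPositive) (x : FockSpace) :
    inner ℂ x (T x) = ((inner ℂ x (T x)).re : ℂ) :=
  (hT.isSymmetric.coe_re_inner_self_apply x).symm

theorem re_inner_nonneg_of_isPositive {T : Operator} (hT : T.IsPositive) (x : FockSpace) :
    0 ≤ (inner ℂ x (T x)).re :=
  hT.re_inner_nonneg_right x

/-- The quadratic form of a positive operator is a sum of squares of linear functionals. -/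
theorem exists_sum_sq_of_isPositive {T : Operator} (hT : T.IsPositive) :
    ∃ f : ℕ → FockSpace, ∀ x : FockSpace,
      ENNReal.ofReal (inner ℂ x (T x)).re = ∑' m, ‖inner ℂ (f m) x‖ₑ ^ 2 := by
  obtain ⟨S, rfl⟩ := exists_eq_adjoint_mul_self hT
  refine ⟨fun m => ContinuousLinearMap.adjoint S (fock m), fun x => ?_⟩
  have h1 : inner ℂ x ((ContinuousLinearMap.adjoint S * S) x) = ((‖S x‖ ^ 2 : ℝ) : ℂ) := by
    change inner ℂ x (ContinuousLinearMap.adjoint S (S x)) = _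
    rw [ContinuousLinearMap.adjoint_inner_right, inner_self_eq_norm_sq_to_K]
    simp
  rw [h1, Complex.ofReal_re, ENNReal.ofReal_pow (norm_nonneg _), ofReal_norm,
    ← tsum_enorm_sq_coord]
  refine tsum_congr fun m => ?_
  rw [ContinuousLinearMap.adjoint_inner_left, inner_fock_left]

/-- The trace is evaluated in the Fock basis; exchanging the two nonnegative sums leaves Parseval
for each `g n`. -/
theorem tsum_enorm_sq_of_isState {ρ : Operator} (hρ : IsState ρ) {g : ℕ → FockSpace}
    (hg : ∀ x : FockSpace, ENNReal.ofReal (inner ℂ x (ρ x)).re = ∑' n, ‖inner ℂ (g n) x‖ₑ ^ 2) :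
    ∑' n, ‖g n‖ₑ ^ 2 = 1 := by
  have h := Complex.hasSum_re hρ.hasSum_trace
  have h2 := ENNReal.ofReal_tsum_of_nonneg
    (fun k => re_inner_nonneg_of_isPositive hρ.isPositive (fock k)) h.summable
  rw [h.tsum_eq] at h2
  simp only [Complex.one_re, ENNReal.ofReal_one, hg] at h2
  rw [h2, ENNReal.tsum_comm]
  refine tsum_congr fun n => ?_
  rw [← tsum_enorm_sq_coord]
  refine tsum_congr fun k => ?_
  rw [inner_fock_right, enorm_conj]

theorem re_inner_le_of_isState {ρ : Operator} (hρ : IsState ρ) (x : FockSpace) :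
    (inner ℂ x (ρ x)).re ≤ ‖x‖ ^ 2 := by
  obtain ⟨g, hg⟩ := exists_sum_sq_of_isPositive hρ.isPositive
  have h : ENNReal.ofReal (inner ℂ x (ρ x)).re ≤ ‖x‖ₑ ^ 2 := by
    rw [hg]
    calc ∑' n, ‖inner ℂ (g n) x‖ₑ ^ 2 ≤ ∑' n, ‖g n‖ₑ ^ 2 * ‖x‖ₑ ^ 2 := by
          refine ENNReal.tsum_le_tsum fun n => ?_
          rw [← mul_pow]
          gcongr
          rw [← ofReal_norm, ← ofReal_norm, ← ofReal_norm, ← ENNReal.ofReal_mul (norm_nonneg _)]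
          exact ENNReal.ofReal_le_ofReal (norm_inner_le_norm _ _)
      _ = ‖x‖ₑ ^ 2 := by rw [ENNReal.tsum_mul_right, tsum_enorm_sq_of_isState hρ hg, one_mul]
  rw [← ofReal_norm, ← ENNReal.ofReal_pow (norm_nonneg _)] at h
  exact (ENNReal.ofReal_le_ofReal_iff (sq_nonneg _)).1 h

/-- With `ρ = S†S`, the bound on the quadratic form says `‖S‖ ≤ 1`. This is what makes the series
defining `MeasurePrepare.channel` converge absolutely in operator norm on pure inputs. -/
theorem norm_le_one_of_isState {ρ : Operator} (hρ : IsState ρ) : ‖ρ‖ ≤ 1 := by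
  obtain ⟨S, hS⟩ := exists_eq_adjoint_mul_self hρ.isPositive
  have h1 : ‖S‖ ≤ 1 := by
    refine ContinuousLinearMap.opNorm_le_bound _ zero_le_one fun x => ?_
    have h := re_inner_le_of_isState hρ x
    have h1 : inner ℂ x (ρ x) = ((‖S x‖ ^ 2 : ℝ) : ℂ) := by
      rw [hS]
      change inner ℂ x (ContinuousLinearMap.adjoint S (S x)) = _
      rw [ContinuousLinearMap.adjoint_inner_right, inner_self_eq_norm_sq_to_K]
      simp
    rw [h1, Complex.ofReal_re] at h
    rw [one_mul]
    exact le_of_sq_le_sq h (norm_nonneg _)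
  rw [hS]
  calc _ ≤ ‖ContinuousLinearMap.adjoint S‖ * ‖S‖ := norm_mul_le _ _
    _ = ‖S‖ * ‖S‖ := by rw [LinearIsometryEquiv.norm_map]
    _ ≤ 1 := mul_le_one₀ h1 (norm_nonneg _) h1

theorem hasSum_re_effect (M : MeasurePrepare) (x : FockSpace) :
    HasSum (fun l => (inner ℂ x (M.effect l x)).re) (‖x‖ ^ 2) := by
  have h := Complex.hasSum_re (M.isPOVM.hasSum_one x x)
  rwa [← RCLike.re_eq_complex_re, inner_self_eq_norm_sq] at h

/-- The fidelity of the channel output with a pure input state, as a sum over the outcomes. -/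
theorem ofReal_trace_channel (M : MeasurePrepare) (ψ : FockSpace) :
    ENNReal.ofReal (trace (M.channel (pureState ψ) * pureState ψ)).re =
      ∑' l, ENNReal.ofReal (inner ℂ ψ (M.effect l ψ)).re *
        ENNReal.ofReal (inner ℂ ψ (M.prepared l ψ)).re := by
  have hE := hasSum_re_effect M ψ
  have hsum : Summable fun l => trace (pureState ψ * M.effect l) • M.prepared l := by
    refine Summable.of_norm_bounded hE.summable fun l => ?_
    rw [trace_pureState_mul, norm_smul, inner_eq_ofReal_of_isPositive (M.isPOVM.isPositive l),
      Complex.norm_real, Complex.ofReal_re, Real.norm_of_nonneg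
        (re_inner_nonneg_of_isPositive (M.isPOVM.isPositive l) ψ)]
    exact mul_le_of_le_one_right (re_inner_nonneg_of_isPositive (M.isPOVM.isPositive l) ψ)
      (norm_le_one_of_isState (M.isState l))
  -- `T ↦ ⟨ψ, Tψ⟩` is a continuous linear functional, so it may be applied to the channel series
  -- term by term.
  have h1 := hsum.hasSum.mapL
    ((innerSL ℂ ψ).comp (ContinuousLinearMap.apply ℂ FockSpace ψ))
  have h2 : HasSum (fun l => (inner ℂ ψ (M.effect l ψ)).re * (inner ℂ ψ (M.prepared l ψ)).re)
      (trace (M.channel (pureState ψ) * pureState ψ)).re := by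
    rw [trace_mul_pureState]
    change HasSum _ (((innerSL ℂ ψ).comp (ContinuousLinearMap.apply ℂ FockSpace ψ))
      (M.channel (pureState ψ))).re
    convert Complex.hasSum_re h1 using 2 with l
    swap
    · rfl
    simp only [ContinuousLinearMap.comp_apply, ContinuousLinearMap.apply_apply,
      smul_apply, innerSL_apply_apply, inner_smul_right, trace_pureState_mul]
    rw [inner_eq_ofReal_of_isPositive (M.isPOVM.isPositive l), Complex.re_ofReal_mul,
      Complex.ofReal_re]
  rw [← h2.tsum_eq, ENNReal.ofReal_tsum_of_nonneg _ h2.summable]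
  · exact tsum_congr fun l => ENNReal.ofReal_mul
      (re_inner_nonneg_of_isPositive (M.isPOVM.isPositive l) ψ)
  · exact fun l => mul_nonneg (re_inner_nonneg_of_isPositive (M.isPOVM.isPositive l) ψ)
      (re_inner_nonneg_of_isPositive (M.isState l).isPositive ψ)

/-! ### Phase-invariant measures and orthogonality of monomials -/

theorem measurable_rotation (φ : ℝ) :
    Measurable fun α : ℂ => Complex.exp (φ * Complex.I) * α :=
  measurable_const_mul _

theorem norm_rotation (φ : ℝ) (α : ℂ) : ‖Complex.exp (φ * Complex.I) * α‖ = ‖α‖ := by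
  rw [norm_mul, Complex.norm_exp_ofReal_mul_I, one_mul]

theorem PhaseInvariant.withDensity_norm {m : Measure ℂ} (hm : PhaseInvariant m) {h : ℝ → ℝ≥0∞}
    (hh : Measurable h) : PhaseInvariant (m.withDensity fun α => h ‖α‖) := by
  intro φ
  ext s hs
  have hs' := measurable_rotation φ hs
  rw [Measure.map_apply (measurable_rotation φ) hs, withDensity_apply _ hs,
    withDensity_apply _ hs']
  conv_rhs => rw [← hm φ]
  rw [setLIntegral_map hs (f := fun α => h ‖α‖) (hh.comp measurable_norm) (measurable_rotation φ)]
  simp only [norm_rotation]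

/-- Rotation by `φ` multiplies the integrand by `e^{iφ(n-k)}`. For `φ = π/(n-k)` this factor is
`-1`, so the integral equals its own negative. -/
theorem PhaseInvariant.integral_pow_mul_conj_pow {m : Measure ℂ} (hm : PhaseInvariant m)
    {n k : ℕ} (hnk : n ≠ k) : ∫ α, α ^ n * (starRingEnd ℂ) (α ^ k) ∂m = 0 := by
  have hd : ((n : ℂ) - k) ≠ 0 := sub_ne_zero.2 (by exact_mod_cast hnk)
  set φ : ℝ := Real.pi / ((n : ℝ) - k) with hφ
  have hφ' : (φ : ℂ) * ((n : ℂ) - k) = Real.pi := by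
    rw [hφ]; push_cast; field_simp
  have hrot : ∀ α : ℂ, (Complex.exp (φ * Complex.I) * α) ^ n *
      (starRingEnd ℂ) ((Complex.exp (φ * Complex.I) * α) ^ k) =
      -(α ^ n * (starRingEnd ℂ) (α ^ k)) := by
    intro α
    have h1 : Complex.exp (φ * Complex.I) ^ n *
        (starRingEnd ℂ) (Complex.exp (φ * Complex.I) ^ k) = -1 := by
      rw [map_pow, ← Complex.exp_conj, ← Complex.exp_nat_mul, ← Complex.exp_nat_mul,
        ← Complex.exp_add, map_mul, Complex.conj_I, Complex.conj_ofReal, ← Complex.exp_pi_mul_I,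
        ← hφ']
      congr 1
      ring
    rw [mul_pow, mul_pow, map_mul]
    linear_combination (α ^ n * (starRingEnd ℂ) (α ^ k)) * h1
  have hcont : Continuous fun α : ℂ => α ^ n * (starRingEnd ℂ) (α ^ k) := by fun_prop
  have h2 : ∫ α, α ^ n * (starRingEnd ℂ) (α ^ k) ∂m =
      -∫ α, α ^ n * (starRingEnd ℂ) (α ^ k) ∂m := by
    conv_lhs => rw [← hm φ]
    rw [integral_map (measurable_rotation φ).aemeasurable hcont.aestronglyMeasurable]
    simp only [hrot]
    rw [integral_neg]
  exact self_eq_neg.1 h2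

/-- Monomials are orthogonal for a phase-invariant measure. -/
theorem PhaseInvariant.lintegral_enorm_sq_sum {m : Measure ℂ} (hm : PhaseInvariant m)
    (hint : ∀ n : ℕ, Integrable (fun α : ℂ => ‖α‖ ^ n) m) (s : Finset ℕ) (c : ℕ → ℂ) :
    ∫⁻ α, ‖∑ n ∈ s, c n * α ^ n‖ₑ ^ 2 ∂m = ∑ n ∈ s, ‖c n‖ₑ ^ 2 * ∫⁻ α, ‖α‖ₑ ^ (2 * n) ∂m := by
  have hint2 : ∀ n k : ℕ, Integrable (fun α : ℂ => α ^ n * (starRingEnd ℂ) (α ^ k)) m := by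
    intro n k
    refine (hint (n + k)).mono' (Continuous.aestronglyMeasurable (by fun_prop)) ?_
    refine Eventually.of_forall fun α => ?_
    rw [norm_mul, RCLike.norm_conj, norm_pow, norm_pow, pow_add]
  have hexp : ∀ α : ℂ, ((‖∑ n ∈ s, c n * α ^ n‖ ^ 2 : ℝ) : ℂ) =
      ∑ n ∈ s, ∑ k ∈ s, (c n * (starRingEnd ℂ) (c k)) * (α ^ n * (starRingEnd ℂ) (α ^ k)) := by
    intro α
    rw [Complex.ofReal_pow, ← Complex.mul_conj', map_sum, Finset.sum_mul_sum]
    refine Finset.sum_congr rfl fun n _ => Finset.sum_congr rfl fun k _ => ?_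
    rw [map_mul]; ring
  have hintsq : Integrable (fun α : ℂ => ‖∑ n ∈ s, c n * α ^ n‖ ^ 2) m := by
    have : Integrable (fun α : ℂ => ((‖∑ n ∈ s, c n * α ^ n‖ ^ 2 : ℝ) : ℂ)) m := by
      simp only [hexp]
      exact integrable_finsetSum _ fun n _ => integrable_finsetSum _ fun k _ =>
        (hint2 n k).const_mul _
    exact this.re
  have hdiag : ∀ n : ℕ, ∫ α : ℂ, α ^ n * (starRingEnd ℂ) (α ^ n) ∂m =
      ((∫ α : ℂ, ‖α‖ ^ (2 * n) ∂m : ℝ) : ℂ) := by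
    intro n
    rw [← integral_complex_ofReal]
    refine integral_congr_ae (Eventually.of_forall fun α => ?_)
    simp only
    rw [Complex.mul_conj', norm_pow]
    push_cast
    ring
  have hreal : ∫ α : ℂ, ‖∑ n ∈ s, c n * α ^ n‖ ^ 2 ∂m =
      ∑ n ∈ s, ‖c n‖ ^ 2 * ∫ α : ℂ, ‖α‖ ^ (2 * n) ∂m := by
    have : ((∫ α : ℂ, ‖∑ n ∈ s, c n * α ^ n‖ ^ 2 ∂m : ℝ) : ℂ) =
        ((∑ n ∈ s, ‖c n‖ ^ 2 * ∫ α : ℂ, ‖α‖ ^ (2 * n) ∂m : ℝ) : ℂ) := by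
      rw [← integral_complex_ofReal]
      simp only [hexp]
      rw [integral_finsetSum _ fun n _ => integrable_finsetSum _ fun k _ =>
        (hint2 n k).const_mul _]
      push_cast
      refine Finset.sum_congr rfl fun n hn => ?_
      rw [integral_finsetSum _ fun k _ => (hint2 n k).const_mul _,
        Finset.sum_eq_single_of_mem n hn, integral_const_mul, hdiag, Complex.mul_conj']
      intro k _ hk
      rw [integral_const_mul, hm.integral_pow_mul_conj_pow hk.symm, mul_zero]
    exact_mod_cast this
  have hl : ∀ z : ℂ, ∀ n : ℕ, ‖z‖ₑ ^ n = ENNReal.ofReal (‖z‖ ^ n) := fun z n => by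
    rw [ENNReal.ofReal_pow (norm_nonneg _), ofReal_norm]
  simp only [hl]
  rw [← ofReal_integral_eq_lintegral_ofReal hintsq (Eventually.of_forall fun _ => by positivity),
    hreal, ENNReal.ofReal_sum_of_nonneg
      fun n _ => mul_nonneg (by positivity) (integral_nonneg fun _ => by positivity)]
  refine Finset.sum_congr rfl fun n _ => ?_
  rw [ENNReal.ofReal_mul (by positivity),
    ofReal_integral_eq_lintegral_ofReal (hint (2 * n)) (Eventually.of_forall fun _ => by positivity)]

/-! ### Weighted Cauchy–Schwarz by total degree -/

/-- Cauchy–Schwarz inequality in `[0,∞]`. -/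
theorem ennreal_sum_sq_le {ι : Type*} (s : Finset ι) (x u v : ι → ℝ≥0∞)
    (h : ∀ i ∈ s, x i ^ 2 ≤ u i * v i) :
    (∑ i ∈ s, x i) ^ 2 ≤ (∑ i ∈ s, u i) * ∑ i ∈ s, v i := by
  have hroot : ∀ a : ℝ≥0∞, (a ^ (1 / 2 : ℝ)) ^ (2 : ℝ) = a := fun a => by
    rw [← ENNReal.rpow_mul]; norm_num
  have h1 : ∑ i ∈ s, x i ≤ (∑ i ∈ s, u i) ^ (1 / 2 : ℝ) * (∑ i ∈ s, v i) ^ (1 / 2 : ℝ) := by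
    calc ∑ i ∈ s, x i ≤ ∑ i ∈ s, u i ^ (1 / 2 : ℝ) * v i ^ (1 / 2 : ℝ) := by
          refine Finset.sum_le_sum fun i hi => ?_
          rw [← ENNReal.mul_rpow_of_nonneg _ _ (by norm_num)]
          have := ENNReal.rpow_le_rpow (h i hi) (z := 1 / 2) (by norm_num)
          rwa [← ENNReal.rpow_natCast, ← ENNReal.rpow_mul, Nat.cast_ofNat,
            mul_one_div_cancel two_ne_zero, ENNReal.rpow_one] at this
      _ ≤ _ := by
          have := ENNReal.inner_le_Lp_mul_Lq s (fun i => u i ^ (1 / 2 : ℝ))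
            (fun i => v i ^ (1 / 2 : ℝ)) (p := 2) (q := 2) Real.HolderConjugate.two_two
          simpa only [hroot] using this
  calc (∑ i ∈ s, x i) ^ 2
      ≤ ((∑ i ∈ s, u i) ^ (1 / 2 : ℝ) * (∑ i ∈ s, v i) ^ (1 / 2 : ℝ)) ^ 2 := by gcongr
    _ = _ := by
      rw [mul_pow, ← ENNReal.rpow_two, ← ENNReal.rpow_two, hroot, hroot]

/-- The monomial `α^k / √(k!)`, orthonormal for the Gaussian measure. -/
def monomialCoeff (α : ℂ) (k : ℕ) : ℂ := α ^ k / (Real.sqrt (k.factorial : ℝ) : ℂ)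

theorem enorm_sqrt_factorial_inv_sq (k : ℕ) :
    ‖((Real.sqrt (k.factorial : ℝ) : ℂ))⁻¹‖ₑ ^ 2 = (k.factorial : ℝ≥0∞)⁻¹ := by
  have h : (0 : ℝ) < k.factorial := by positivity
  rw [← ofReal_norm, ← ENNReal.ofReal_pow (norm_nonneg _), norm_inv, Complex.norm_real,
    Real.norm_of_nonneg (Real.sqrt_nonneg _), inv_pow, Real.sq_sqrt h.le,
    ENNReal.ofReal_inv_of_pos h, ENNReal.ofReal_natCast]

theorem factorial_mul_inv_mul_inv (k l : ℕ) :
    ((k + l).factorial : ℝ≥0∞) * ((k.factorial : ℝ≥0∞)⁻¹ * (l.factorial : ℝ≥0∞)⁻¹) =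
      ((k + l).choose k : ℝ≥0∞) := by
  have hk : (k.factorial : ℝ≥0∞) ≠ 0 := by exact_mod_cast k.factorial_ne_zero
  have hl : (l.factorial : ℝ≥0∞) ≠ 0 := by exact_mod_cast l.factorial_ne_zero
  have h : (k + l).choose k * k.factorial * l.factorial = (k + l).factorial := by
    have := Nat.choose_mul_factorial_mul_factorial (Nat.le_add_right k l)
    simpa using this
  rw [← h]
  push_cast
  calc _ = ((k + l).choose k : ℝ≥0∞) * (k.factorial * (k.factorial : ℝ≥0∞)⁻¹) *
        (l.factorial * (l.factorial : ℝ≥0∞)⁻¹) := by ring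
    _ = _ := by
      rw [ENNReal.mul_inv_cancel hk (ENNReal.natCast_ne_top _),
        ENNReal.mul_inv_cancel hl (ENNReal.natCast_ne_top _), mul_one, mul_one]

/-- The weighted Cauchy–Schwarz estimate in one total-degree sector. -/
theorem moment_mul_enorm_sum_sq_le {q : ℕ → ℝ≥0∞} (hq : ∀ k, q k ≠ ∞) {a B : ℝ≥0∞} (hB : B ≠ ∞)
    (N : ℕ) (ha : a * ∑ k ∈ Finset.range (N + 1), (N.choose k : ℝ≥0∞) / q k ≤ B)
    (s : Finset (ℕ × ℕ)) (hs : s ⊆ Finset.HasAntidiagonal.antidiagonal N) (f g : ℕ → ℂ) :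
    ‖∑ i ∈ s, f i.1 * g i.2 * ((Real.sqrt (i.1.factorial : ℝ) : ℂ)⁻¹ *
        (Real.sqrt (i.2.factorial : ℝ) : ℂ)⁻¹)‖ₑ ^ 2 * (N.factorial * a) ≤
      B * ∑ i ∈ s, q i.1 * ‖f i.1‖ₑ ^ 2 * ‖g i.2‖ₑ ^ 2 := by
  -- A vanishing moment is treated separately: by `0 · ∞ = 0`, the hypothesis then says nothing
  -- about the weights.
  rcases eq_or_ne a 0 with rfl | ha0
  · simp
  -- A zero weight would make the sum infinite, contradicting `B ≠ ∞` since `a ≠ 0`. The weights can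
  -- therefore be cancelled below.
  have hq0 : ∀ k ∈ Finset.range (N + 1), q k ≠ 0 := by
    intro k hk h0
    have hC : (N.choose k : ℝ≥0∞) ≠ 0 := by
      exact_mod_cast (Nat.choose_pos (Nat.lt_succ_iff.1 (Finset.mem_range.1 hk))).ne'
    have : ∑ k ∈ Finset.range (N + 1), (N.choose k : ℝ≥0∞) / q k = ∞ := by
      rw [ENNReal.sum_eq_top]
      exact ⟨k, hk, by rw [h0, ENNReal.div_zero hC]⟩
    rw [this, ENNReal.mul_top ha0] at ha
    exact hB (top_le_iff.1 ha)
  have hs1 : ∀ i ∈ s, i.1 + i.2 = N := fun i hi => Finset.HasAntidiagonal.mem_antidiagonal.1 (hs hi)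
  set u : ℕ × ℕ → ℝ≥0∞ := fun i =>
    (i.1.factorial : ℝ≥0∞)⁻¹ * (i.2.factorial : ℝ≥0∞)⁻¹ * (q i.1)⁻¹ with hu
  set v : ℕ × ℕ → ℝ≥0∞ := fun i => q i.1 * ‖f i.1‖ₑ ^ 2 * ‖g i.2‖ₑ ^ 2 with hv
  have h1 : ‖∑ i ∈ s, f i.1 * g i.2 * ((Real.sqrt (i.1.factorial : ℝ) : ℂ)⁻¹ *
        (Real.sqrt (i.2.factorial : ℝ) : ℂ)⁻¹)‖ₑ ^ 2 ≤ (∑ i ∈ s, u i) * ∑ i ∈ s, v i := by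
    refine le_trans (pow_le_pow_left' (enorm_sum_le _ _) 2) (ennreal_sum_sq_le _ _ _ _ ?_)
    intro i hi
    have hi0 : q i.1 ≠ 0 := hq0 _ (Finset.mem_range.2 (by have := hs1 i hi; omega))
    refine le_of_eq ?_
    rw [enorm_mul, enorm_mul, enorm_mul, mul_pow, mul_pow, mul_pow,
      enorm_sqrt_factorial_inv_sq, enorm_sqrt_factorial_inv_sq]
    calc _ = (i.1.factorial : ℝ≥0∞)⁻¹ * (i.2.factorial : ℝ≥0∞)⁻¹ * ((q i.1)⁻¹ * q i.1) *
          (‖f i.1‖ₑ ^ 2 * ‖g i.2‖ₑ ^ 2) := by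
          rw [ENNReal.inv_mul_cancel hi0 (hq _)]; ring
      _ = _ := by rw [hu, hv]; ring
  have h2 : (N.factorial : ℝ≥0∞) * ∑ i ∈ s, u i ≤
      ∑ k ∈ Finset.range (N + 1), (N.choose k : ℝ≥0∞) / q k := by
    rw [← Finset.Nat.sum_antidiagonal_eq_sum_range_succ_mk
      (fun i : ℕ × ℕ => (N.choose i.1 : ℝ≥0∞) / q i.1), Finset.mul_sum]
    refine le_trans (le_of_eq ?_) (Finset.sum_le_sum_of_subset hs)
    refine Finset.sum_congr rfl fun i hi => ?_
    rw [hu, ← hs1 i hi, ← factorial_mul_inv_mul_inv, div_eq_mul_inv]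
    ring
  calc _ ≤ ((∑ i ∈ s, u i) * ∑ i ∈ s, v i) * (N.factorial * a) := by gcongr
    _ = (a * (N.factorial * ∑ i ∈ s, u i)) * ∑ i ∈ s, v i := by ring
    _ ≤ (a * ∑ k ∈ Finset.range (N + 1), (N.choose k : ℝ≥0∞) / q k) * ∑ i ∈ s, v i := by gcongr
    _ ≤ B * ∑ i ∈ s, v i := by gcongr

/-- The product of the two truncated series is regrouped by total degree `N`. Orthogonality
decouples the degrees, and the sector estimate applies to each. Truncation may cut an antidiagonal,
which is why the sector estimate allows any subset of it. -/
theorem PhaseInvariant.lintegral_mul_le {m : Measure ℂ} (hm : PhaseInvariant m)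
    (hint : ∀ n : ℕ, Integrable (fun α : ℂ => ‖α‖ ^ n) m) {a : ℕ → ℝ≥0∞}
    (ha : ∀ N : ℕ, ∫⁻ α, ‖α‖ₑ ^ (2 * N) ∂m = N.factorial * a N)
    {q : ℕ → ℝ≥0∞} (hq : ∀ k, q k ≠ ∞) {B : ℝ≥0∞} (hB : B ≠ ∞)
    (hle : ∀ N, a N * ∑ k ∈ Finset.range (N + 1), (N.choose k : ℝ≥0∞) / q k ≤ B)
    (f g : ℕ → ℂ) (K : ℕ) :
    ∫⁻ α, ‖(∑ k ∈ Finset.range K, f k * monomialCoeff α k) *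
        ∑ k ∈ Finset.range K, g k * monomialCoeff α k‖ₑ ^ 2 ∂m ≤
      B * ((∑ k ∈ Finset.range K, q k * ‖f k‖ₑ ^ 2) * ∑ k ∈ Finset.range K, ‖g k‖ₑ ^ 2) := by
  set s := Finset.range K ×ˢ Finset.range K with hs
  set t := Finset.range (2 * K) with ht
  have hmap : ∀ i ∈ s, i.1 + i.2 ∈ t := by
    intro i hi
    rw [hs, Finset.mem_product, Finset.mem_range, Finset.mem_range] at hi
    rw [ht, Finset.mem_range]
    omega
  set c : ℕ → ℂ := fun N => ∑ i ∈ s with i.1 + i.2 = N,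
    f i.1 * g i.2 * ((Real.sqrt (i.1.factorial : ℝ) : ℂ)⁻¹ *
        (Real.sqrt (i.2.factorial : ℝ) : ℂ)⁻¹) with hc
  have hpoly : ∀ α : ℂ, (∑ k ∈ Finset.range K, f k * monomialCoeff α k) *
        ∑ k ∈ Finset.range K, g k * monomialCoeff α k = ∑ N ∈ t, c N * α ^ N := by
    intro α
    rw [Finset.sum_mul_sum, ← Finset.sum_product', ← Finset.sum_fiberwise_of_maps_to hmap]
    refine Finset.sum_congr rfl fun N _ => ?_
    rw [hc, Finset.sum_mul]
    refine Finset.sum_congr rfl fun i hi => ?_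
    rw [← (Finset.mem_filter.1 hi).2, monomialCoeff, monomialCoeff, pow_add]
    ring
  simp only [hpoly]
  rw [hm.lintegral_enorm_sq_sum hint]
  calc ∑ N ∈ t, ‖c N‖ₑ ^ 2 * ∫⁻ α, ‖α‖ₑ ^ (2 * N) ∂m
      ≤ ∑ N ∈ t, B * ∑ i ∈ s with i.1 + i.2 = N, q i.1 * ‖f i.1‖ₑ ^ 2 * ‖g i.2‖ₑ ^ 2 := by
        refine Finset.sum_le_sum fun N _ => ?_
        rw [ha]
        exact moment_mul_enorm_sum_sq_le hq hB N (hle N) _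
          (fun i hi => Finset.HasAntidiagonal.mem_antidiagonal.2 (Finset.mem_filter.1 hi).2) f g
    _ = _ := by
        rw [← Finset.mul_sum, Finset.sum_fiberwise_of_maps_to hmap, Finset.sum_mul_sum,
          ← Finset.sum_product']

/-! ### Coherent-state integrals and the upper bound -/

theorem coherent_apply (α : ℂ) (k : ℕ) :
    (coherent α : ℕ → ℂ) k = (Real.exp (-‖α‖ ^ 2 / 2) : ℂ) * monomialCoeff α k := rfl

theorem tendsto_inner_coherent (f : FockSpace) (α : ℂ) :
    Tendsto (fun K => (Real.exp (-‖α‖ ^ 2 / 2) : ℂ) *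
      ∑ k ∈ Finset.range K, (starRingEnd ℂ) (f k) * monomialCoeff α k) atTop
      (𝓝 (inner ℂ f (coherent α))) := by
  refine (hasSum_inner_coord f (coherent α)).tendsto_sum_nat.congr fun K => ?_
  rw [Finset.mul_sum]
  refine Finset.sum_congr rfl fun k _ => ?_
  rw [coherent_apply]
  ring

theorem continuous_monomialCoeff (k : ℕ) : Continuous fun α => monomialCoeff α k := by
  unfold monomialCoeff
  fun_prop

theorem measurable_inner_coherent (f : FockSpace) :
    Measurable fun α => inner ℂ f (coherent α) := by
  refine measurable_of_tendsto_metrizable (f := fun K α => (Real.exp (-‖α‖ ^ 2 / 2) : ℂ) *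
      ∑ k ∈ Finset.range K, (starRingEnd ℂ) (f k) * monomialCoeff α k) (fun K => ?_) ?_
  · have := continuous_monomialCoeff
    exact Continuous.measurable (by fun_prop)
  · exact tendsto_pi_nhds.2 fun α => tendsto_inner_coherent f α

/-- Combines `tⁿ ≤ 1 + t²ⁿ` with `t²ⁿ/n! ≤ e^{t²}`. Boundedness makes all the weighted moments
finite for any finite measure, with no moment assumption on `p`. -/
theorem exp_neg_mul_pow_le {b t : ℝ} (hb : 1 ≤ b) (ht : 0 ≤ t) (n : ℕ) :
    Real.exp (-b * t ^ 2) * t ^ n ≤ 1 + n.factorial := by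
  have h1 : t ^ n ≤ 1 + (t ^ 2) ^ n := by
    rw [← pow_mul, mul_comm 2 n, pow_mul]
    nlinarith [sq_nonneg (t ^ n - 1), pow_nonneg ht n]
  have h2 : (t ^ 2) ^ n ≤ n.factorial * Real.exp (t ^ 2) := by
    have := Real.pow_div_factorial_le_exp (t ^ 2) (sq_nonneg t) n
    rwa [div_le_iff₀ (by positivity), mul_comm] at this
  have h3 : Real.exp (-b * t ^ 2) ≤ Real.exp (-t ^ 2) :=
    Real.exp_le_exp.2 (by nlinarith [sq_nonneg t])
  have h4 : Real.exp (-t ^ 2) ≤ 1 := Real.exp_le_one_iff.2 (by nlinarith [sq_nonneg t])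
  have h5 : Real.exp (-t ^ 2) * Real.exp (t ^ 2) = 1 := by rw [← Real.exp_add]; simp
  calc Real.exp (-b * t ^ 2) * t ^ n ≤ Real.exp (-t ^ 2) * (1 + n.factorial * Real.exp (t ^ 2)) :=
        mul_le_mul h3 (by linarith) (by positivity) (Real.exp_pos _).le
    _ = Real.exp (-t ^ 2) + n.factorial * (Real.exp (-t ^ 2) * Real.exp (t ^ 2)) := by ring
    _ ≤ 1 + n.factorial := by rw [h5]; linarith

theorem integrable_exp_mul_pow (p : Measure ℂ) [IsFiniteMeasure p] {b : ℝ} (hb : 1 ≤ b) (n : ℕ) :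
    Integrable (fun α : ℂ => Real.exp (-b * ‖α‖ ^ 2) * ‖α‖ ^ n) p := by
  refine Integrable.mono' (integrable_const (1 + (n.factorial : ℝ)))
    (Continuous.aestronglyMeasurable (by fun_prop)) (Eventually.of_forall fun α => ?_)
  rw [Real.norm_of_nonneg (by positivity)]
  exact exp_neg_mul_pow_le hb (norm_nonneg α) n

theorem factorial_mul_ofReal_mu (p : Measure ℂ) [IsFiniteMeasure p] (N : ℕ) :
    (N.factorial : ℝ≥0∞) * ENNReal.ofReal (mu p N) =
      ∫⁻ α, ENNReal.ofReal (Real.exp (-2 * ‖α‖ ^ 2)) * ‖α‖ₑ ^ (2 * N) ∂p := by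
  have hN : (N.factorial : ℝ) ≠ 0 := by positivity
  rw [← ENNReal.ofReal_natCast, ← ENNReal.ofReal_mul (by positivity), mu, ← mul_assoc,
    mul_one_div_cancel hN, one_mul, ofReal_integral_eq_lintegral_ofReal
      (integrable_exp_mul_pow p one_le_two _) (Eventually.of_forall fun _ => by positivity)]
  refine lintegral_congr fun α => ?_
  rw [ENNReal.ofReal_mul (Real.exp_pos _).le, ENNReal.ofReal_pow (norm_nonneg _), ofReal_norm]

/-- The normalisations of the two coherent states contribute `e^{-2|α|²}`, which is absorbed into
the measure: the result is still phase-invariant and has moments `N! μ_N`. The polynomial estimate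
then holds uniformly in the truncation, and Fatou's lemma removes the truncation. -/
theorem lintegral_inner_coherent_le (p : Measure ℂ) [IsFiniteMeasure p] (hp : PhaseInvariant p)
    {q : ℕ → ℝ≥0∞} (hq : ∀ k, q k ≠ ∞) (hB : benchmark p q ≠ ∞) (f g : FockSpace) :
    ∫⁻ α, ‖inner ℂ f (coherent α)‖ₑ ^ 2 * ‖inner ℂ g (coherent α)‖ₑ ^ 2 ∂p ≤
      benchmark p q * ((∑' k, q k * ‖f k‖ₑ ^ 2) * ‖g‖ₑ ^ 2) := by
  set m := p.withDensity fun α => ENNReal.ofReal (Real.exp (-2 * ‖α‖ ^ 2)) with hmdef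
  have hdens : Measurable fun α : ℂ => ENNReal.ofReal (Real.exp (-2 * ‖α‖ ^ 2)) := by fun_prop
  have hm : PhaseInvariant m :=
    hp.withDensity_norm (h := fun t => ENNReal.ofReal (Real.exp (-2 * t ^ 2))) (by fun_prop)
  have hint : ∀ n : ℕ, Integrable (fun α : ℂ => ‖α‖ ^ n) m := by
    intro n
    rw [hmdef, integrable_withDensity_iff hdens (Eventually.of_forall fun _ =>
      ENNReal.ofReal_lt_top)]
    refine (integrable_exp_mul_pow p one_le_two n).congr (Eventually.of_forall fun α => ?_)
    simp only
    rw [ENNReal.toReal_ofReal (Real.exp_pos _).le, mul_comm]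
  have hmom : ∀ N : ℕ, ∫⁻ α, ‖α‖ₑ ^ (2 * N) ∂m = N.factorial * ENNReal.ofReal (mu p N) := by
    intro N
    rw [factorial_mul_ofReal_mu, hmdef,
      lintegral_withDensity_eq_lintegral_mul _ hdens (by fun_prop)]
    rfl
  set F : ℕ → ℂ → ℂ := fun K α => (Real.exp (-‖α‖ ^ 2 / 2) : ℂ) *
      ∑ k ∈ Finset.range K, (starRingEnd ℂ) (f k) * monomialCoeff α k with hF
  set G : ℕ → ℂ → ℂ := fun K α => (Real.exp (-‖α‖ ^ 2 / 2) : ℂ) *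
      ∑ k ∈ Finset.range K, (starRingEnd ℂ) (g k) * monomialCoeff α k with hG
  have hcont := continuous_monomialCoeff
  have hlim : ∀ α, Tendsto (fun K => ‖F K α * G K α‖ₑ ^ 2) atTop
      (𝓝 (‖inner ℂ f (coherent α)‖ₑ ^ 2 * ‖inner ℂ g (coherent α)‖ₑ ^ 2)) := by
    intro α
    rw [← mul_pow, ← enorm_mul]
    exact ENNReal.Tendsto.pow
      ((tendsto_inner_coherent f α).mul (tendsto_inner_coherent g α)).enorm
  have hbound : ∀ K, ∫⁻ α, ‖F K α * G K α‖ₑ ^ 2 ∂p ≤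
      benchmark p q * ((∑' k, q k * ‖f k‖ₑ ^ 2) * ‖g‖ₑ ^ 2) := by
    intro K
    have h1 : ∀ α, ‖F K α * G K α‖ₑ ^ 2 = ENNReal.ofReal (Real.exp (-2 * ‖α‖ ^ 2)) *
        ‖(∑ k ∈ Finset.range K, (starRingEnd ℂ) (f k) * monomialCoeff α k) *
          ∑ k ∈ Finset.range K, (starRingEnd ℂ) (g k) * monomialCoeff α k‖ₑ ^ 2 := by
      intro α
      rw [hF, hG]
      simp only
      rw [mul_mul_mul_comm, enorm_mul, mul_pow]
      congr 1
      rw [← Complex.ofReal_mul, ← Real.exp_add, ← ofReal_norm, Complex.norm_real,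
        Real.norm_of_nonneg (Real.exp_pos _).le, ← ENNReal.ofReal_pow (Real.exp_pos _).le,
        ← Real.exp_nat_mul]
      congr 2
      push_cast
      ring
    have h2 := hm.lintegral_mul_le hint hmom hq hB
      (fun N => le_iSup (fun N => ENNReal.ofReal (mu p N) *
        ∑ k ∈ Finset.range (N + 1), (N.choose k : ℝ≥0∞) / q k) N)
      (fun k => (starRingEnd ℂ) (f k)) (fun k => (starRingEnd ℂ) (g k)) K
    rw [hmdef, lintegral_withDensity_eq_lintegral_mul _ hdens
      (Continuous.measurable (by fun_prop))] at h2
    simp only [h1]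
    refine h2.trans ?_
    simp only [enorm_conj]
    rw [← tsum_enorm_sq_coord]
    exact mul_le_mul_right (mul_le_mul' (ENNReal.sum_le_tsum _) (ENNReal.sum_le_tsum _)) _
  calc _ = ∫⁻ α, liminf (fun K => ‖F K α * G K α‖ₑ ^ 2) atTop ∂p :=
        lintegral_congr fun α => (hlim α).liminf_eq.symm
    _ ≤ liminf (fun K => ∫⁻ α, ‖F K α * G K α‖ₑ ^ 2 ∂p) atTop :=
        lintegral_liminf_le fun K => Continuous.measurable (by fun_prop)
    _ ≤ _ := liminf_le_of_le (by isBoundedDefault) fun b hb => by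
        obtain ⟨K, hK⟩ := hb.exists
        exact hK.trans (hbound K)

theorem lintegral_effect_mul_state_le (p : Measure ℂ) [IsFiniteMeasure p] (hp : PhaseInvariant p)
    {q : ℕ → ℝ≥0∞} (hq : ∀ k, q k ≠ ∞) (hB : benchmark p q ≠ ∞) {E ρ : Operator}
    (hE : E.IsPositive) (hρ : IsState ρ) :
    ∫⁻ α, ENNReal.ofReal (inner ℂ (coherent α) (E (coherent α))).re *
        ENNReal.ofReal (inner ℂ (coherent α) (ρ (coherent α))).re ∂p ≤
      benchmark p q * ∑' k, q k * ENNReal.ofReal (inner ℂ (fock k) (E (fock k))).re := by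
  obtain ⟨f, hf⟩ := exists_sum_sq_of_isPositive hE
  obtain ⟨g, hg⟩ := exists_sum_sq_of_isPositive hρ.isPositive
  have hmeas := measurable_inner_coherent
  simp only [hf, hg, inner_fock_right, enorm_conj, ← ENNReal.tsum_mul_right,
    ← ENNReal.tsum_mul_left]
  calc _ = ∑' n, ∑' m, ∫⁻ α, ‖inner ℂ (f m) (coherent α)‖ₑ ^ 2 *
          ‖inner ℂ (g n) (coherent α)‖ₑ ^ 2 ∂p := by
        rw [lintegral_tsum fun n => (by fun_prop)]
        refine tsum_congr fun n => ?_
        rw [lintegral_tsum fun m => (by fun_prop)]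
    _ = ∑' m, ∑' n, ∫⁻ α, ‖inner ℂ (f m) (coherent α)‖ₑ ^ 2 *
          ‖inner ℂ (g n) (coherent α)‖ₑ ^ 2 ∂p := ENNReal.tsum_comm
    _ ≤ ∑' m, ∑' n, benchmark p q * ((∑' k, q k * ‖f m k‖ₑ ^ 2) * ‖g n‖ₑ ^ 2) :=
        ENNReal.tsum_le_tsum fun m => ENNReal.tsum_le_tsum fun n =>
          lintegral_inner_coherent_le p hp hq hB _ _
    _ = ∑' m, ∑' k, benchmark p q * (q k * ‖f m k‖ₑ ^ 2) := by
        refine tsum_congr fun m => ?_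
        rw [ENNReal.tsum_mul_left, ENNReal.tsum_mul_left, tsum_enorm_sq_of_isState hρ hg, mul_one,
          ENNReal.tsum_mul_left]
    _ = _ := ENNReal.tsum_comm

theorem measurable_ofReal_inner_coherent {T : Operator} (hT : T.IsPositive) :
    Measurable fun α => ENNReal.ofReal (inner ℂ (coherent α) (T (coherent α))).re := by
  obtain ⟨f, hf⟩ := exists_sum_sq_of_isPositive hT
  have hmeas := measurable_inner_coherent
  simp only [hf]
  fun_prop

theorem classicalFidelity_le_benchmark (p : Measure ℂ) [IsFiniteMeasure p]
    (hp : PhaseInvariant p) (q : PMF ℕ) :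
    classicalFidelity p coherent ≤ benchmark p (fun k => q k) := by
  -- The sector estimate needs a finite bound; an infinite benchmark is trivial.
  rcases eq_or_ne (benchmark p fun k => q k) ∞ with hB | hB
  · rw [hB]; exact le_top
  refine iSup_le fun M => ?_
  simp only [ofReal_trace_channel]
  rw [lintegral_tsum fun l => ((measurable_ofReal_inner_coherent (M.isPOVM.isPositive l)).fun_mul
    (measurable_ofReal_inner_coherent (M.isState l).isPositive)).aemeasurable]
  calc _ ≤ ∑' l, benchmark p (fun k => q k) *
          ∑' k, q k * ENNReal.ofReal (inner ℂ (fock k) (M.effect l (fock k))).re :=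
        ENNReal.tsum_le_tsum fun l => lintegral_effect_mul_state_le p hp
          (fun k => q.apply_ne_top k) hB (M.isPOVM.isPositive l) (M.isState l)
    _ = benchmark p (fun k => q k) * ∑' k, q k *
          ∑' l, ENNReal.ofReal (inner ℂ (fock k) (M.effect l (fock k))).re := by
        rw [ENNReal.tsum_mul_left, ENNReal.tsum_comm]
        simp only [ENNReal.tsum_mul_left]
    _ = benchmark p (fun k => q k) := by
        have h1 : ∀ k, ∑' l, ENNReal.ofReal (inner ℂ (fock k) (M.effect l (fock k))).re = 1 := by
          intro k
          have h := hasSum_re_effect M (fock k)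
          have hn : ‖fock k‖ = 1 := by simp [fock, lp.norm_single]
          rw [← ENNReal.ofReal_tsum_of_nonneg (fun l => re_inner_nonneg_of_isPositive
            (M.isPOVM.isPositive l) _) h.summable, h.tsum_eq, hn]
          simp
        simp only [h1, mul_one, q.tsum_coe]

/-- For fixed `α` the integrands are the Poisson weights of mean `|α|²`, which sum to one. -/
theorem tsum_ofReal_nu (p : Measure ℂ) [IsProbabilityMeasure p] :
    ∑' k, ENNReal.ofReal (nu p k) = 1 := by
  have h1 : ∀ k, ENNReal.ofReal (nu p k) =
      ∫⁻ α, ENNReal.ofReal (Real.exp (-‖α‖ ^ 2) * ((‖α‖ ^ 2) ^ k / k.factorial)) ∂p := by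
    intro k
    have hint : Integrable (fun α : ℂ => Real.exp (-‖α‖ ^ 2) * ‖α‖ ^ (2 * k)) p := by
      simpa using integrable_exp_mul_pow p le_rfl (2 * k)
    rw [nu, ← integral_const_mul, ofReal_integral_eq_lintegral_ofReal (hint.const_mul _)
      (Eventually.of_forall fun _ => by positivity)]
    refine lintegral_congr fun α => ?_
    congr 1
    rw [pow_mul]
    ring
  simp only [h1]
  rw [← lintegral_tsum fun k => (by fun_prop)]
  have h2 : ∀ α : ℂ, ∑' k : ℕ,
      ENNReal.ofReal (Real.exp (-‖α‖ ^ 2) * ((‖α‖ ^ 2) ^ k / k.factorial)) = 1 := by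
    intro α
    have h := (NormedSpace.expSeries_div_hasSum_exp (‖α‖ ^ 2)).mul_left (Real.exp (-‖α‖ ^ 2))
    rw [← ENNReal.ofReal_tsum_of_nonneg (fun k => by positivity) h.summable, h.tsum_eq,
      ← Real.exp_eq_exp_ℝ, ← Real.exp_add]
    simp
  simp [h2]

theorem iInf_benchmark_le (p : Measure ℂ) [IsProbabilityMeasure p] :
    (⨅ q : PMF ℕ, benchmark p (fun k => q k)) ≤
      benchmark p (fun k => ENNReal.ofReal (nu p k)) :=
  iInf_le (fun q : PMF ℕ => benchmark p (fun k => q k))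
    ⟨fun k => ENNReal.ofReal (nu p k), tsum_ofReal_nu p ▸ ENNReal.summable.hasSum⟩

/-! ### Gaussian priors and the value of the benchmark -/

theorem integral_exp_neg_mul_norm_pow {b : ℝ} (hb : 0 < b) (N : ℕ) :
    ∫ α : ℂ, Real.exp (-b * ‖α‖ ^ 2) * ‖α‖ ^ (2 * N) =
      Real.pi * N.factorial / b ^ (N + 1) := by
  have h := Complex.integral_rpow_mul_exp_neg_mul_rpow (p := 2) (q := (2 * N : ℕ)) (b := b)
    one_le_two (by have : (0 : ℝ) ≤ ((2 * N : ℕ) : ℝ) := Nat.cast_nonneg _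
                   linarith) hb
  have h1 : ((2 * N : ℕ) + 2 : ℝ) / 2 = N + 1 := by push_cast; ring
  have h2 : -((2 * N : ℕ) + 2 : ℝ) / 2 = -((N + 1 : ℕ) : ℝ) := by push_cast; ring
  rw [h1, h2, Real.Gamma_nat_eq_factorial, Real.rpow_neg hb.le, Real.rpow_natCast] at h
  simp only [Real.rpow_natCast, Real.rpow_two] at h
  simp only [mul_comm (Real.exp _)]
  rw [h]
  field_simp

/-- The Bochner integral of a non-integrable function is `0` by convention, whereas the computed
value is positive. -/
theorem integrable_exp_neg_mul_norm_pow {b : ℝ} (hb : 0 < b) (N : ℕ) :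
    Integrable fun α : ℂ => Real.exp (-b * ‖α‖ ^ 2) * ‖α‖ ^ (2 * N) := by
  by_contra h
  have h1 := integral_exp_neg_mul_norm_pow hb N
  rw [integral_undef h] at h1
  have : (0 : ℝ) < Real.pi * N.factorial / b ^ (N + 1) := by positivity
  linarith

theorem lintegral_exp_neg_mul_norm_sq {b : ℝ} (hb : 0 < b) :
    ∫⁻ α : ℂ, ENNReal.ofReal (Real.exp (-b * ‖α‖ ^ 2)) = ENNReal.ofReal (Real.pi / b) := by
  have h1 := integral_exp_neg_mul_norm_pow hb 0
  have h2 := integrable_exp_neg_mul_norm_pow hb 0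
  simp only [mul_zero, pow_zero, mul_one, zero_add, pow_one, Nat.factorial_zero,
    Nat.cast_one] at h1 h2
  rw [← ofReal_integral_eq_lintegral_ofReal h2 (Eventually.of_forall fun _ => by positivity), h1]

theorem measurable_gaussian_density (r : ℝ) :
    Measurable fun α : ℂ => ENNReal.ofReal (r / Real.pi * Real.exp (-r * ‖α‖ ^ 2)) := by
  fun_prop

theorem isProbabilityMeasure_gaussian {r : ℝ} (hr : 0 < r) :
    IsProbabilityMeasure (gaussian r) := by
  constructor
  rw [gaussian, withDensity_apply _ MeasurableSet.univ, Measure.restrict_univ]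
  simp only [ENNReal.ofReal_mul (show 0 ≤ r / Real.pi by positivity)]
  rw [lintegral_const_mul _ (by fun_prop), lintegral_exp_neg_mul_norm_sq hr,
    ← ENNReal.ofReal_mul (by positivity), div_mul_div_cancel₀ Real.pi_ne_zero, div_self hr.ne',
    ENNReal.ofReal_one]

theorem phaseInvariant_volume : PhaseInvariant (volume : Measure ℂ) := by
  intro φ
  exact (rotation (Circle.exp φ)).measurePreserving.map_eq

theorem phaseInvariant_gaussian (r : ℝ) : PhaseInvariant (gaussian r) :=
  phaseInvariant_volume.withDensity_norm
    (h := fun t => ENNReal.ofReal (r / Real.pi * Real.exp (-r * t ^ 2))) (by fun_prop)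

theorem integral_gaussian {r : ℝ} (hr : 0 < r) (F : ℂ → ℝ) :
    ∫ α, F α ∂gaussian r = r / Real.pi * ∫ α, Real.exp (-r * ‖α‖ ^ 2) * F α := by
  rw [gaussian, integral_withDensity_eq_integral_toReal_smul (measurable_gaussian_density r)
    (Eventually.of_forall fun _ => ENNReal.ofReal_lt_top), ← integral_const_mul]
  refine integral_congr_ae (Eventually.of_forall fun α => ?_)
  simp only
  rw [ENNReal.toReal_ofReal (by positivity), smul_eq_mul, mul_assoc]

theorem integral_exp_neg_mul_norm_pow_gaussian {b r : ℝ} (hr : 0 < r) (hb : 0 ≤ b) (N : ℕ) :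
    1 / (N.factorial : ℝ) * ∫ α, Real.exp (-b * ‖α‖ ^ 2) * ‖α‖ ^ (2 * N) ∂gaussian r =
      r / (b + r) ^ (N + 1) := by
  have h : ∀ α : ℂ, Real.exp (-r * ‖α‖ ^ 2) * (Real.exp (-b * ‖α‖ ^ 2) * ‖α‖ ^ (2 * N)) =
      Real.exp (-(b + r) * ‖α‖ ^ 2) * ‖α‖ ^ (2 * N) := by
    intro α
    rw [← mul_assoc, ← Real.exp_add]
    congr 2
    ring
  rw [integral_gaussian hr]
  simp only [h]
  rw [integral_exp_neg_mul_norm_pow (by positivity)]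
  have := Real.pi_ne_zero
  field_simp

theorem mu_gaussian {r : ℝ} (hr : 0 < r) (N : ℕ) : mu (gaussian r) N = r / (2 + r) ^ (N + 1) :=
  integral_exp_neg_mul_norm_pow_gaussian hr zero_le_two N

theorem nu_gaussian {r : ℝ} (hr : 0 < r) (k : ℕ) : nu (gaussian r) k = r / (1 + r) ^ (k + 1) := by
  have := integral_exp_neg_mul_norm_pow_gaussian hr zero_le_one k
  simpa [nu] using this

theorem benchmark_gaussian {r : ℝ} (hr : 0 < r) :
    benchmark (gaussian r) (fun k => ENNReal.ofReal (nu (gaussian r) k)) =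
      ENNReal.ofReal ((1 + r) / (2 + r)) := by
  have h : ∀ N : ℕ, ENNReal.ofReal (mu (gaussian r) N) * ∑ k ∈ Finset.range (N + 1),
      (N.choose k : ℝ≥0∞) / ENNReal.ofReal (nu (gaussian r) k) =
        ENNReal.ofReal ((1 + r) / (2 + r)) := by
    intro N
    have h1 : ∀ k, (N.choose k : ℝ≥0∞) / ENNReal.ofReal (nu (gaussian r) k) =
        ENNReal.ofReal ((1 + r) / r * ((1 + r) ^ k * (N.choose k))) := by
      intro k
      rw [nu_gaussian hr, ← ENNReal.ofReal_natCast, ← ENNReal.ofReal_div_of_pos (by positivity)]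
      congr 1
      field_simp
      ring
    simp only [h1]
    -- Binomial expansion of `((1 + r) + 1)^N`; it cancels the `N`-dependence of `μ_N`, so the
    -- supremum is over a constant.
    have h2 : ∑ k ∈ Finset.range (N + 1), (1 + r) ^ k * (N.choose k : ℝ) = (2 + r) ^ N := by
      have := add_pow (1 + r) 1 N
      simp only [one_pow, mul_one] at this
      rw [← this]
      ring
    rw [← ENNReal.ofReal_sum_of_nonneg fun k _ => by positivity, ← Finset.mul_sum, h2,
      mu_gaussian hr, ← ENNReal.ofReal_mul (by positivity)]
    congr 1
    field_simp
    ring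
  simp [benchmark, h]

/-! ### Overlaps and continuity of coherent states -/

theorem inner_coherent (α β : ℂ) : inner ℂ (coherent α) (coherent β) =
    (Real.exp (-‖α‖ ^ 2 / 2) : ℂ) * (Real.exp (-‖β‖ ^ 2 / 2) : ℂ) *
      Complex.exp ((starRingEnd ℂ) α * β) := by
  have h := (NormedSpace.expSeries_div_hasSum_exp ((starRingEnd ℂ) α * β)).mul_left
    ((Real.exp (-‖α‖ ^ 2 / 2) : ℂ) * (Real.exp (-‖β‖ ^ 2 / 2) : ℂ))
  rw [← Complex.exp_eq_exp_ℂ] at h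
  rw [← (hasSum_inner_coord (coherent α) (coherent β)).tsum_eq, ← h.tsum_eq]
  refine tsum_congr fun k => ?_
  have hk : ((Real.sqrt (k.factorial : ℝ) : ℂ)) * (Real.sqrt (k.factorial : ℝ) : ℂ) =
      (k.factorial : ℂ) := by
    rw [← Complex.ofReal_mul, Real.mul_self_sqrt (by positivity), Complex.ofReal_natCast]
  rw [coherent_apply, coherent_apply, monomialCoeff, monomialCoeff, ← hk, map_mul, map_div₀,
    Complex.conj_ofReal, Complex.conj_ofReal, map_pow, mul_pow, ← div_mul_div_comm]
  ring

theorem enorm_inner_coherent_sq (α β : ℂ) :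
    ‖inner ℂ (coherent α) (coherent β)‖ₑ ^ 2 = ENNReal.ofReal (Real.exp (-‖α - β‖ ^ 2)) := by
  rw [inner_coherent, ← ofReal_norm, ← ENNReal.ofReal_pow (norm_nonneg _), norm_mul, norm_mul,
    Complex.norm_real, Complex.norm_real, Complex.norm_exp,
    Real.norm_of_nonneg (Real.exp_pos _).le, Real.norm_of_nonneg (Real.exp_pos _).le,
    ← Real.exp_add, ← Real.exp_add, ← Real.exp_nat_mul]
  congr 2
  rw [Complex.sq_norm, Complex.sq_norm, Complex.sq_norm, Complex.normSq_apply,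
    Complex.normSq_apply, Complex.normSq_apply]
  simp
  ring

theorem norm_coherent (α : ℂ) : ‖coherent α‖ = 1 := by
  have h : inner ℂ (coherent α) (coherent α) = 1 := by
    rw [inner_coherent, Complex.conj_mul', ← Complex.ofReal_mul, ← Real.exp_add, ← Complex.ofReal_pow,
      ← Complex.ofReal_exp, ← Complex.ofReal_mul, ← Real.exp_add]
    ring_nf
    simp
  have h2 : ‖coherent α‖ ^ 2 = 1 := by
    rw [← inner_self_eq_norm_sq (𝕜 := ℂ), h]
    simp
  exact (pow_eq_one_iff_of_nonneg (norm_nonneg _) two_ne_zero).1 h2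

/-- For unit vectors the squared distance is `2 - 2 Re⟨α|β⟩`, so continuity reduces to that of the
explicit overlap. -/
theorem continuous_coherent : Continuous coherent := by
  rw [continuous_iff_continuousAt]
  intro β
  rw [ContinuousAt, tendsto_iff_norm_sub_tendsto_zero]
  have h1 : ∀ α, ‖coherent α - coherent β‖ =
      Real.sqrt (2 - 2 * (inner ℂ (coherent α) (coherent β)).re) := by
    intro α
    rw [← Real.sqrt_sq (norm_nonneg (coherent α - coherent β)), norm_sub_sq (𝕜 := ℂ),
      norm_coherent, norm_coherent, RCLike.re_eq_complex_re]
    ring_nf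
  simp only [h1, inner_coherent]
  have h2 : Continuous fun α : ℂ => Real.sqrt (2 - 2 * ((Real.exp (-‖α‖ ^ 2 / 2) : ℂ) *
      (Real.exp (-‖β‖ ^ 2 / 2) : ℂ) * Complex.exp ((starRingEnd ℂ) α * β)).re) := by fun_prop
  have h3 := h2.tendsto β
  rwa [← inner_coherent, inner_self_eq_norm_sq_to_K, norm_coherent, show
    (2 - 2 * ((RCLike.ofReal (1 : ℝ) : ℂ) ^ 2).re) = 0 by simp, Real.sqrt_zero] at h3

theorem continuous_pureState_coherent : Continuous fun β => pureState (coherent β) := by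
  have h1 : Continuous fun β => ContinuousLinearMap.toSpanSingleton ℂ (coherent β) :=
    (ContinuousLinearMap.toSpanSingletonLIE ℂ FockSpace).continuous.comp continuous_coherent
  have h2 : Continuous fun β => innerSL ℂ (coherent β) :=
    (innerSL ℂ).continuous.comp continuous_coherent
  simp only [pureState, InnerProductSpace.rankOne_def']
  exact h1.clm_comp h2

theorem isState_pureState_coherent (γ : ℂ) : IsState (pureState (coherent γ)) where
  isPositive := InnerProductSpace.isPositive_rankOne_self _
  hasSum_trace := by
    have h := hasSum_inner_coord (coherent γ) (coherent γ)
    rw [inner_self_eq_norm_sq_to_K, norm_coherent] at h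
    simp only [pureState_apply, inner_smul_right, inner_fock_left, inner_fock_right]
    simpa using h

theorem ofReal_inner_pureState (ψ x : FockSpace) :
    ENNReal.ofReal (inner ℂ x (pureState ψ x)).re = ‖inner ℂ ψ x‖ₑ ^ 2 := by
  rw [pureState_apply, inner_smul_right, ← inner_conj_symm x ψ, Complex.mul_conj',
    ← Complex.ofReal_pow, Complex.ofReal_re, ENNReal.ofReal_pow (norm_nonneg _), ofReal_norm]

/-! ### Heterodyne detection and its discretisation -/

/-- The measure `d²β/π` for which the coherent states resolve the identity. -/
def heterodyneMeasure : Measure ℂ := ENNReal.ofReal (Real.pi⁻¹) • volume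

theorem heterodyneMeasure_lt_top {D : Set ℂ} (hD : Bornology.IsBounded D) :
    heterodyneMeasure D < ∞ := by
  rw [heterodyneMeasure, Measure.smul_apply, smul_eq_mul]
  exact ENNReal.mul_lt_top ENNReal.ofReal_lt_top hD.measure_lt_top

theorem lintegral_enorm_pow_gaussian_one (N : ℕ) :
    ∫⁻ α, ‖α‖ₑ ^ (2 * N) ∂gaussian 1 = N.factorial := by
  rw [gaussian, lintegral_withDensity_eq_lintegral_mul _ (measurable_gaussian_density 1)
    (by fun_prop)]
  have h : ∀ α : ℂ, ((fun α : ℂ => ENNReal.ofReal (1 / Real.pi * Real.exp (-1 * ‖α‖ ^ 2))) *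
      fun α : ℂ => ‖α‖ₑ ^ (2 * N)) α =
      ENNReal.ofReal (1 / Real.pi * (Real.exp (-1 * ‖α‖ ^ 2) * ‖α‖ ^ (2 * N))) := by
    intro α
    rw [← mul_assoc, ENNReal.ofReal_mul (by positivity), ENNReal.ofReal_pow (norm_nonneg _),
      ofReal_norm]
    rfl
  simp only [h]
  rw [← ofReal_integral_eq_lintegral_ofReal
    ((integrable_exp_neg_mul_norm_pow one_pos N).const_mul _)
    (Eventually.of_forall fun _ => by positivity), integral_const_mul,
    integral_exp_neg_mul_norm_pow one_pos, ← ENNReal.ofReal_natCast]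
  congr 1
  have := Real.pi_ne_zero
  field_simp
  simp

theorem integrable_norm_pow_gaussian_one (n : ℕ) :
    Integrable (fun α : ℂ => ‖α‖ ^ n) (gaussian 1) := by
  have hfin : ∀ N : ℕ, Integrable (fun α : ℂ => ‖α‖ ^ (2 * N)) (gaussian 1) := by
    intro N
    refine ⟨Continuous.aestronglyMeasurable (by fun_prop), ?_⟩
    rw [HasFiniteIntegral]
    simp only [enorm_pow, enorm_norm]
    rw [lintegral_enorm_pow_gaussian_one]
    exact ENNReal.natCast_lt_top _
  -- Only even moments were computed; the others follow from `‖α‖ⁿ ≤ 1 + ‖α‖²ⁿ`.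
  refine ((hfin 0).add (hfin n)).mono' (Continuous.aestronglyMeasurable (by fun_prop))
    (Eventually.of_forall fun α => ?_)
  rw [Real.norm_of_nonneg (by positivity)]
  simp only [Pi.add_apply, mul_zero, pow_zero]
  rw [mul_comm 2 n, pow_mul]
  nlinarith [sq_nonneg (‖α‖ ^ n - 1), pow_nonneg (norm_nonneg α) n]

/-- Bessel's inequality for the coherent states. -/
theorem lintegral_inner_coherent_sq_le (x : FockSpace) :
    ∫⁻ β, ‖inner ℂ x (coherent β)‖ₑ ^ 2 ∂heterodyneMeasure ≤ ‖x‖ₑ ^ 2 := by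
  set P : ℕ → ℂ → ℂ := fun K β =>
    ∑ k ∈ Finset.range K, (starRingEnd ℂ) (x k) * monomialCoeff β k with hP
  set F : ℕ → ℂ → ℂ := fun K β => (Real.exp (-‖β‖ ^ 2 / 2) : ℂ) * P K β with hF
  have hcont := continuous_monomialCoeff
  have hbound : ∀ K, ∫⁻ β, ‖F K β‖ₑ ^ 2 ∂heterodyneMeasure ≤ ‖x‖ₑ ^ 2 := by
    intro K
    have h1 : ∫⁻ β, ‖F K β‖ₑ ^ 2 ∂heterodyneMeasure = ∫⁻ β, ‖P K β‖ₑ ^ 2 ∂gaussian 1 := by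
      rw [heterodyneMeasure, lintegral_smul_measure, gaussian,
        lintegral_withDensity_eq_lintegral_mul _ (measurable_gaussian_density 1)
          (Continuous.measurable (by fun_prop)), smul_eq_mul,
        ← lintegral_const_mul _ (Continuous.measurable (by fun_prop))]
      refine lintegral_congr fun β => ?_
      rw [Pi.mul_apply, ENNReal.ofReal_mul (by positivity), one_div, mul_assoc, hF]
      simp only
      rw [enorm_mul, mul_pow]
      congr 2
      rw [← ofReal_norm, Complex.norm_real, Real.norm_of_nonneg (Real.exp_pos _).le,
        ← ENNReal.ofReal_pow (Real.exp_pos _).le, ← Real.exp_nat_mul]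
      congr 2
      push_cast
      ring
    have h2 : ∀ β, P K β = ∑ k ∈ Finset.range K,
        ((starRingEnd ℂ) (x k) * (Real.sqrt (k.factorial : ℝ) : ℂ)⁻¹) * β ^ k := by
      intro β
      refine Finset.sum_congr rfl fun k _ => ?_
      rw [monomialCoeff]
      ring
    rw [h1]
    simp only [h2]
    rw [(phaseInvariant_gaussian 1).lintegral_enorm_sq_sum integrable_norm_pow_gaussian_one,
      ← tsum_enorm_sq_coord]
    refine le_trans (le_of_eq ?_) (ENNReal.sum_le_tsum (Finset.range K))
    refine Finset.sum_congr rfl fun k _ => ?_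
    rw [lintegral_enorm_pow_gaussian_one, enorm_mul, mul_pow, enorm_sqrt_factorial_inv_sq,
      enorm_conj, mul_assoc, ENNReal.inv_mul_cancel (by exact_mod_cast k.factorial_ne_zero)
        (ENNReal.natCast_ne_top _), mul_one]
  calc _ = ∫⁻ β, liminf (fun K => ‖F K β‖ₑ ^ 2) atTop ∂heterodyneMeasure :=
        lintegral_congr fun β =>
          (ENNReal.Tendsto.pow (tendsto_inner_coherent x β).enorm).liminf_eq.symm
    _ ≤ liminf (fun K => ∫⁻ β, ‖F K β‖ₑ ^ 2 ∂heterodyneMeasure) atTop :=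
        lintegral_liminf_le fun K => Continuous.measurable (by fun_prop)
    _ ≤ _ := liminf_le_of_le (by isBoundedDefault) fun b hb => by
        obtain ⟨K, hK⟩ := hb.exists
        exact hK.trans (hbound K)

/-- The heterodyne effect of the outcome set `D`. -/
def heterodyneEffect (D : Set ℂ) : Operator :=
  ∫ β in D, pureState (coherent β) ∂heterodyneMeasure

theorem integrableOn_pureState_coherent {D : Set ℂ} (hD : Bornology.IsBounded D) :
    IntegrableOn (fun β => pureState (coherent β)) D heterodyneMeasure := by
  have : IsFiniteMeasure (heterodyneMeasure.restrict D) :=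
    ⟨by rw [Measure.restrict_apply_univ]; exact heterodyneMeasure_lt_top hD⟩
  refine Integrable.mono' (integrable_const (1 : ℝ))
    continuous_pureState_coherent.aestronglyMeasurable (Eventually.of_forall fun β => ?_)
  exact norm_le_one_of_isState (isState_pureState_coherent β)

theorem integrableOn_inner_pureState {D : Set ℂ} (hD : Bornology.IsBounded D) (x y : FockSpace) :
    IntegrableOn (fun β => inner ℂ x (pureState (coherent β) y)) D heterodyneMeasure := by
  have : IsFiniteMeasure (heterodyneMeasure.restrict D) :=
    ⟨by rw [Measure.restrict_apply_univ]; exact heterodyneMeasure_lt_top hD⟩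
  refine Integrable.mono' (integrable_const (‖x‖ * ‖y‖)) (Continuous.aestronglyMeasurable
    (continuous_const.inner (continuous_pureState_coherent.clm_apply continuous_const)))
    (Eventually.of_forall fun β => (norm_inner_le_norm _ _).trans ?_)
  gcongr
  exact (ContinuousLinearMap.le_of_opNorm_le _
    (norm_le_one_of_isState (isState_pureState_coherent β)) y).trans_eq (one_mul _)

theorem inner_heterodyneEffect {D : Set ℂ} (hD : Bornology.IsBounded D) (x y : FockSpace) :
    inner ℂ x (heterodyneEffect D y) =
      ∫ β in D, inner ℂ x (pureState (coherent β) y) ∂heterodyneMeasure :=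
  (((innerSL ℂ x).comp (ContinuousLinearMap.apply ℂ FockSpace y)).integral_comp_comm
    (integrableOn_pureState_coherent hD)).symm

theorem inner_pureState_self (ψ x : FockSpace) :
    inner ℂ x (pureState ψ x) = ((‖inner ℂ ψ x‖ ^ 2 : ℝ) : ℂ) := by
  rw [pureState_apply, inner_smul_right, ← inner_conj_symm x ψ, Complex.mul_conj',
    ← Complex.ofReal_pow]

theorem inner_heterodyneEffect_self {D : Set ℂ} (hD : Bornology.IsBounded D) (x : FockSpace) :
    inner ℂ x (heterodyneEffect D x) =
      ((∫ β in D, ‖inner ℂ (coherent β) x‖ ^ 2 ∂heterodyneMeasure : ℝ) : ℂ) := by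
  rw [inner_heterodyneEffect hD, ← integral_complex_ofReal]
  simp only [inner_pureState_self]

theorem ofReal_inner_heterodyneEffect {D : Set ℂ} (hD : Bornology.IsBounded D) (x : FockSpace) :
    ENNReal.ofReal (inner ℂ x (heterodyneEffect D x)).re =
      ∫⁻ β in D, ‖inner ℂ (coherent β) x‖ₑ ^ 2 ∂heterodyneMeasure := by
  have hint : IntegrableOn (fun β => ‖inner ℂ (coherent β) x‖ ^ 2) D heterodyneMeasure := by
    have h := integrableOn_inner_pureState hD x x
    simp only [inner_pureState_self] at h
    exact h.re
  rw [inner_heterodyneEffect_self hD, Complex.ofReal_re, ofReal_integral_eq_lintegral_ofReal hint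
    (Eventually.of_forall fun _ => by positivity)]
  refine lintegral_congr fun β => ?_
  rw [ENNReal.ofReal_pow (norm_nonneg _), ofReal_norm]

theorem isPositive_heterodyneEffect {D : Set ℂ} (hD : Bornology.IsBounded D) :
    (heterodyneEffect D).IsPositive := by
  rw [ContinuousLinearMap.isPositive_iff_complex]
  intro x
  have h : inner ℂ (heterodyneEffect D x) x =
      ((∫ β in D, ‖inner ℂ (coherent β) x‖ ^ 2 ∂heterodyneMeasure : ℝ) : ℂ) := by
    rw [← inner_conj_symm, inner_heterodyneEffect_self hD, Complex.conj_ofReal]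
  rw [h]
  exact ⟨by simp, by simpa using integral_nonneg fun _ => by positivity⟩

/-- This is Bessel's inequality restricted to the window. The full resolution of the identity is not
needed, since the missing part can be assigned to some outcome. -/
theorem isPositive_one_sub_heterodyneEffect {D : Set ℂ} (hD : Bornology.IsBounded D) :
    (1 - heterodyneEffect D).IsPositive := by
  rw [ContinuousLinearMap.isPositive_iff_complex]
  intro x
  have h : inner ℂ ((1 - heterodyneEffect D) x) x =
      ((‖x‖ ^ 2 - (inner ℂ x (heterodyneEffect D x)).re : ℝ) : ℂ) := by
    rw [sub_apply, inner_sub_left, ← inner_conj_symm (heterodyneEffect D x) x,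
      inner_heterodyneEffect_self hD, Complex.conj_ofReal, Complex.ofReal_re, Complex.ofReal_sub]
    congr 1
    exact (inner_self_eq_norm_sq_to_K x).trans (by simp)
  have h2 : ENNReal.ofReal (inner ℂ x (heterodyneEffect D x)).re ≤ ENNReal.ofReal (‖x‖ ^ 2) := by
    rw [ofReal_inner_heterodyneEffect hD, ENNReal.ofReal_pow (norm_nonneg _), ofReal_norm]
    refine le_trans (setLIntegral_le_lintegral _ _) (le_trans (le_of_eq ?_)
      (lintegral_inner_coherent_sq_le x))
    refine lintegral_congr fun β => ?_
    rw [← inner_conj_symm, enorm_conj]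
  rw [ENNReal.ofReal_le_ofReal_iff (sq_nonneg _)] at h2
  rw [h]
  refine ⟨congrArg _ (Complex.ofReal_re _), ?_⟩
  rw [RCLike.re_eq_complex_re, Complex.ofReal_re]
  linarith

/-- Heterodyne detection on the window `D`, with outcomes coarse-grained by `J`, followed by the
preparation of the coherent state `γ l` upon outcome `l`. -/
def heterodyneMeasurePrepare {D : Set ℂ} (hD : Bornology.IsBounded D) (hDm : MeasurableSet D)
    {J : ℂ → ℕ} (hJ : Measurable J) (γ : ℕ → ℂ) : MeasurePrepare where
  -- The remainder `1 - heterodyneEffect D` is added to outcome `0` so that the effects sum to the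
  -- identity.
  effect l := heterodyneEffect (D ∩ J ⁻¹' {l}) + if l = 0 then 1 - heterodyneEffect D else 0
  prepared l := pureState (coherent (γ l))
  isPOVM := by
    constructor
    · intro l
      refine (isPositive_heterodyneEffect (hD.subset Set.inter_subset_left)).add ?_
      split_ifs
      · exact isPositive_one_sub_heterodyneEffect hD
      · exact ContinuousLinearMap.isPositive_zero
    · intro x y
      have hU : (⋃ l, D ∩ J ⁻¹' {l}) = D := by
        rw [← Set.inter_iUnion, ← Set.preimage_iUnion, Set.iUnion_of_singleton, Set.preimage_univ,
          Set.inter_univ]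
      have h1 := hasSum_integral_iUnion (μ := heterodyneMeasure)
        (f := fun β => inner ℂ x (pureState (coherent β) y)) (s := fun l => D ∩ J ⁻¹' {l})
        (fun l => hDm.inter (hJ (measurableSet_singleton l)))
        (fun l l' hll => by
          refine Set.disjoint_left.2 fun β hβ hβ' => hll ?_
          exact hβ.2.symm.trans hβ'.2)
        (by rw [hU]; exact integrableOn_inner_pureState hD x y)
      rw [hU, ← inner_heterodyneEffect hD] at h1
      have h2 := hasSum_ite_eq (0 : ℕ) (inner ℂ x ((1 - heterodyneEffect D) y))
      have h3 := h1.add h2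
      have e : inner ℂ x (heterodyneEffect D y) + inner ℂ x ((1 - heterodyneEffect D) y) =
          inner ℂ x y := by
        rw [← inner_add_right, sub_apply]
        simp
      rw [e] at h3
      have e' : (fun l => inner ℂ x ((heterodyneEffect (D ∩ J ⁻¹' {l}) +
          if l = 0 then 1 - heterodyneEffect D else 0) y)) = fun l =>
          ∫ β in D ∩ J ⁻¹' {l}, inner ℂ x (pureState (coherent β) y) ∂heterodyneMeasure +
            if l = 0 then inner ℂ x ((1 - heterodyneEffect D) y) else 0 := by
        funext l
        rw [add_apply, inner_add_right, inner_heterodyneEffect (hD.subset Set.inter_subset_left)]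
        split_ifs
        · rfl
        · simp
      rw [e']
      exact h3
  isState l := isState_pureState_coherent (γ l)

/-- On each cell the prepared state is constant and factors out of the integral. The inequality
comes from discarding the nonnegative contribution of the remainder in outcome `0`. -/
theorem le_ofReal_trace_heterodyne {D : Set ℂ} (hD : Bornology.IsBounded D)
    (hDm : MeasurableSet D) {J : ℂ → ℕ} (hJ : Measurable J) (γ : ℕ → ℂ) (α : ℂ) :
    ∫⁻ β in D, ENNReal.ofReal (Real.exp (-‖β - α‖ ^ 2)) *
        ENNReal.ofReal (Real.exp (-‖γ (J β) - α‖ ^ 2)) ∂heterodyneMeasure ≤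
      ENNReal.ofReal (trace ((heterodyneMeasurePrepare hD hDm hJ γ).channel
        (pureState (coherent α)) * pureState (coherent α))).re := by
  have hU : D = ⋃ l, D ∩ J ⁻¹' {l} := by
    rw [← Set.inter_iUnion, ← Set.preimage_iUnion, Set.iUnion_of_singleton, Set.preimage_univ,
      Set.inter_univ]
  have hCm : ∀ l, MeasurableSet (D ∩ J ⁻¹' {l}) :=
    fun l => hDm.inter (hJ (measurableSet_singleton l))
  rw [ofReal_trace_channel]
  conv_lhs => rw [hU]
  rw [lintegral_iUnion hCm (fun l l' hll => by
    refine Set.disjoint_left.2 fun β hβ hβ' => hll ?_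
    exact hβ.2.symm.trans hβ'.2)]
  refine ENNReal.tsum_le_tsum fun l => ?_
  have h1 : ∫⁻ β in D ∩ J ⁻¹' {l}, ENNReal.ofReal (Real.exp (-‖β - α‖ ^ 2)) *
        ENNReal.ofReal (Real.exp (-‖γ (J β) - α‖ ^ 2)) ∂heterodyneMeasure =
      (∫⁻ β in D ∩ J ⁻¹' {l}, ENNReal.ofReal (Real.exp (-‖β - α‖ ^ 2)) ∂heterodyneMeasure) *
        ENNReal.ofReal (Real.exp (-‖γ l - α‖ ^ 2)) := by
    rw [← lintegral_mul_const _ (by fun_prop)]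
    refine setLIntegral_congr_fun (hCm l) fun β hβ => ?_
    have : J β = l := hβ.2
    simp only [this]
  have h2 : ENNReal.ofReal (inner ℂ (coherent α) ((heterodyneMeasurePrepare hD hDm hJ γ).prepared l
      (coherent α))).re = ENNReal.ofReal (Real.exp (-‖γ l - α‖ ^ 2)) := by
    rw [← enorm_inner_coherent_sq]
    exact ofReal_inner_pureState _ _
  rw [h1, h2]
  refine mul_le_mul_left ?_ _
  have h3 := ofReal_inner_heterodyneEffect (hD.subset (Set.inter_subset_left (t := J ⁻¹' {l})))
    (coherent α)
  simp only [enorm_inner_coherent_sq] at h3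
  rw [← h3]
  refine ENNReal.ofReal_le_ofReal ?_
  change _ ≤ (inner ℂ (coherent α) ((heterodyneEffect (D ∩ J ⁻¹' {l}) +
    if l = 0 then 1 - heterodyneEffect D else 0) (coherent α))).re
  rw [add_apply, inner_add_right, Complex.add_re]
  refine le_add_of_nonneg_right (re_inner_nonneg_of_isPositive ?_ _)
  split_ifs
  · exact isPositive_one_sub_heterodyneEffect hD
  · exact ContinuousLinearMap.isPositive_zero

/-- Heterodyne detection followed by the preparation of a rescaled coherent state can be
approximated by discrete measure-and-prepare channels. -/
theorem lintegral_heterodyne_le_classicalFidelity (p : Measure ℂ) (c : ℂ) :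
    ∫⁻ α, ∫⁻ β, ENNReal.ofReal (Real.exp (-‖β - α‖ ^ 2)) *
        ENNReal.ofReal (Real.exp (-‖c * β - α‖ ^ 2)) ∂heterodyneMeasure ∂p ≤
      classicalFidelity p coherent := by
  obtain ⟨e, he⟩ := TopologicalSpace.exists_dense_seq ℂ
  set D : ℕ → Set ℂ := fun n => Metric.closedBall 0 n with hDdef
  have hDb : ∀ n, Bornology.IsBounded (D n) := fun n => Metric.isBounded_closedBall
  have hDm : ∀ n, MeasurableSet (D n) := fun n => Metric.isClosed_closedBall.measurableSet
  -- The integrand realised by the `n`-th discrete scheme: outcomes in the ball of radius `n`,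
  -- rounded to a nearest point among the first terms of a dense sequence.
  set F : ℕ → ℂ → ℂ → ℝ≥0∞ := fun n α => (D n).indicator fun β =>
    ENNReal.ofReal (Real.exp (-‖β - α‖ ^ 2)) *
      ENNReal.ofReal (Real.exp (-‖c * e (SimpleFunc.nearestPtInd e n β) - α‖ ^ 2)) with hF
  have hFm : ∀ n, Measurable fun z : ℂ × ℂ => F n z.1 z.2 := by
    intro n
    have h : Measurable fun β => e (SimpleFunc.nearestPtInd e n β) :=
      (SimpleFunc.nearestPt e n).measurable
    have h' : Measurable fun z : ℂ × ℂ => ENNReal.ofReal (Real.exp (-‖z.2 - z.1‖ ^ 2)) *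
      ENNReal.ofReal (Real.exp (-‖c * e (SimpleFunc.nearestPtInd e n z.2) - z.1‖ ^ 2)) := by fun_prop
    exact h'.indicator (measurable_snd (hDm n))
  have hlim : ∀ α β, Tendsto (fun n => F n α β) atTop
      (𝓝 (ENNReal.ofReal (Real.exp (-‖β - α‖ ^ 2)) *
        ENNReal.ofReal (Real.exp (-‖c * β - α‖ ^ 2)))) := by
    intro α β
    have h1 : Tendsto (fun n => e (SimpleFunc.nearestPtInd e n β)) atTop (𝓝 β) :=
      SimpleFunc.tendsto_nearestPt (by
        rw [he.closure_range]; trivial)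
    have h2 : Continuous fun w : ℂ => ENNReal.ofReal (Real.exp (-‖β - α‖ ^ 2) *
        Real.exp (-‖c * w - α‖ ^ 2)) :=
      ENNReal.continuous_ofReal.comp (by fun_prop)
    have h3 := (h2.tendsto β).comp h1
    simp only [Function.comp_def, ENNReal.ofReal_mul (Real.exp_pos _).le] at h3
    refine h3.congr' ?_
    filter_upwards [eventually_ge_atTop ⌈‖β‖⌉₊] with n hn
    have hβ : β ∈ D n := by
      rw [hDdef, Metric.mem_closedBall, dist_zero_right]
      exact (Nat.le_ceil _).trans (by exact_mod_cast hn)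
    rw [hF]
    simp only
    rw [Set.indicator_of_mem hβ]
  have hbound : ∀ n, ∫⁻ α, ∫⁻ β, F n α β ∂heterodyneMeasure ∂p ≤
      classicalFidelity p coherent := by
    intro n
    have hJ : Measurable (SimpleFunc.nearestPtInd e n) := SimpleFunc.measurable _
    set M := heterodyneMeasurePrepare (hDb n) (hDm n) hJ (fun l => c * e l) with hM
    calc ∫⁻ α, ∫⁻ β, F n α β ∂heterodyneMeasure ∂p
        ≤ ∫⁻ α, ENNReal.ofReal
          (trace (M.channel (pureState (coherent α)) * pureState (coherent α))).re ∂p := by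
          refine lintegral_mono fun α => ?_
          have h := le_ofReal_trace_heterodyne (hDb n) (hDm n) hJ (fun l => c * e l) α
          rw [← hM, ← lintegral_indicator (hDm n)] at h
          exact h
      _ ≤ classicalFidelity p coherent := le_iSup (fun M : MeasurePrepare => ∫⁻ a, ENNReal.ofReal
          (trace (M.channel (pureState (coherent a)) * pureState (coherent a))).re ∂p) M
  have : SFinite heterodyneMeasure := by unfold heterodyneMeasure; infer_instance
  -- Fatou's lemma is applied twice, first in `β`, then in `α`.
  calc _ = ∫⁻ α, ∫⁻ β, liminf (fun n => F n α β) atTop ∂heterodyneMeasure ∂p :=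
        lintegral_congr fun α => lintegral_congr fun β => (hlim α β).liminf_eq.symm
    _ ≤ ∫⁻ α, liminf (fun n => ∫⁻ β, F n α β ∂heterodyneMeasure) atTop ∂p :=
        lintegral_mono fun α => lintegral_liminf_le fun n =>
          (hFm n).comp (measurable_const.prodMk measurable_id)
    _ ≤ liminf (fun n => ∫⁻ α, ∫⁻ β, F n α β ∂heterodyneMeasure ∂p) atTop :=
        lintegral_liminf_le fun n => (hFm n).lintegral_prod_right'
    _ ≤ _ := liminf_le_of_le (by isBoundedDefault) fun b hb => by
        obtain ⟨n, hn⟩ := hb.exists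
        exact hn.trans (hbound n)

/-! ### Fidelity of the rescaled heterodyne scheme for Gaussian priors -/

/-- Completing the square in `α`. If `|cβ⟩` is prepared, the centre is `(1+c)β/(2+r)`, and it
coincides with `cβ` exactly for `c = 1/(1+r)`, the posterior mean factor. -/
theorem heterodyne_exponent {r : ℝ} (hr : 0 < r) (α β : ℂ) :
    -r * ‖α‖ ^ 2 + (-‖β - α‖ ^ 2 + -‖((1 + r)⁻¹ : ℝ) * β - α‖ ^ 2) =
      -(2 + r) * ‖α - ((1 + r)⁻¹ : ℝ) * β‖ ^ 2 + -(r / (1 + r)) * ‖β‖ ^ 2 := by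
  have h : 1 + r ≠ 0 := by positivity
  simp only [Complex.sq_norm, Complex.normSq_apply, Complex.sub_re, Complex.sub_im,
    Complex.re_ofReal_mul, Complex.im_ofReal_mul]
  field_simp
  ring

theorem lintegral_heterodyne_gaussian {r : ℝ} (hr : 0 < r) :
    ∫⁻ α, ∫⁻ β, ENNReal.ofReal (Real.exp (-‖β - α‖ ^ 2)) *
        ENNReal.ofReal (Real.exp (-‖((1 + r)⁻¹ : ℝ) * β - α‖ ^ 2)) ∂heterodyneMeasure ∂gaussian r =
      ENNReal.ofReal ((1 + r) / (2 + r)) := by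
  have hmeas : Measurable fun z : ℂ × ℂ => ENNReal.ofReal (Real.exp (-‖z.2 - z.1‖ ^ 2)) *
      ENNReal.ofReal (Real.exp (-‖((1 + r)⁻¹ : ℝ) * z.2 - z.1‖ ^ 2)) := by fun_prop
  have hpt : ∀ α β : ℂ, ENNReal.ofReal (r / Real.pi * Real.exp (-r * ‖α‖ ^ 2)) *
      (ENNReal.ofReal (Real.exp (-‖β - α‖ ^ 2)) *
        ENNReal.ofReal (Real.exp (-‖((1 + r)⁻¹ : ℝ) * β - α‖ ^ 2))) =
      ENNReal.ofReal (r / Real.pi) * ENNReal.ofReal (Real.exp (-(r / (1 + r)) * ‖β‖ ^ 2)) *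
        ENNReal.ofReal (Real.exp (-(2 + r) * ‖α - ((1 + r)⁻¹ : ℝ) * β‖ ^ 2)) := by
    intro α β
    rw [← ENNReal.ofReal_mul (Real.exp_pos _).le, ← ENNReal.ofReal_mul (by positivity),
      ← ENNReal.ofReal_mul (by positivity), ← ENNReal.ofReal_mul (by positivity), mul_assoc,
      mul_assoc, ← Real.exp_add, ← Real.exp_add, ← Real.exp_add, heterodyne_exponent hr,
      add_comm]
  calc _ = ENNReal.ofReal Real.pi⁻¹ * ∫⁻ α : ℂ, ENNReal.ofReal (r / Real.pi * Real.exp (-r * ‖α‖ ^ 2)) *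
        ∫⁻ β : ℂ, ENNReal.ofReal (Real.exp (-‖β - α‖ ^ 2)) *
          ENNReal.ofReal (Real.exp (-‖((1 + r)⁻¹ : ℝ) * β - α‖ ^ 2)) := by
        simp only [heterodyneMeasure, lintegral_smul_measure, smul_eq_mul]
        rw [lintegral_const_mul _ hmeas.lintegral_prod_right', gaussian,
          lintegral_withDensity_eq_lintegral_mul _ (measurable_gaussian_density r)
            hmeas.lintegral_prod_right']
        rfl
    _ = ENNReal.ofReal Real.pi⁻¹ * ∫⁻ β : ℂ, ∫⁻ α : ℂ, ENNReal.ofReal (r / Real.pi) *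
          ENNReal.ofReal (Real.exp (-(r / (1 + r)) * ‖β‖ ^ 2)) *
        ENNReal.ofReal (Real.exp (-(2 + r) * ‖α - ((1 + r)⁻¹ : ℝ) * β‖ ^ 2)) := by
        -- After Tonelli the `α`-integral is a translated Gaussian, whose value does not depend on
        -- `β`.
        rw [← lintegral_lintegral_swap (Measurable.aemeasurable (by fun_prop))]
        congr 1
        refine lintegral_congr fun α => ?_
        rw [← lintegral_const_mul _ (by fun_prop)]
        exact lintegral_congr fun β => hpt α β
    _ = ENNReal.ofReal Real.pi⁻¹ * ∫⁻ β : ℂ, ENNReal.ofReal (r / Real.pi) *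
          ENNReal.ofReal (Real.exp (-(r / (1 + r)) * ‖β‖ ^ 2)) *
            ENNReal.ofReal (Real.pi / (2 + r)) := by
        congr 1
        refine lintegral_congr fun β => ?_
        rw [lintegral_const_mul _ (by fun_prop), lintegral_sub_right_eq_self
          (fun α : ℂ => ENNReal.ofReal (Real.exp (-(2 + r) * ‖α‖ ^ 2))),
          lintegral_exp_neg_mul_norm_sq (by positivity)]
    _ = _ := by
        rw [lintegral_mul_const _ (by fun_prop), lintegral_const_mul _ (by fun_prop),
          lintegral_exp_neg_mul_norm_sq (by positivity), ← ENNReal.ofReal_mul (by positivity),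
          ← ENNReal.ofReal_mul (by positivity), ← ENNReal.ofReal_mul (by positivity)]
        congr 1
        have := Real.pi_ne_zero
        field_simp

theorem le_classicalFidelity_gaussian {r : ℝ} (hr : 0 < r) :
    ENNReal.ofReal ((1 + r) / (2 + r)) ≤ classicalFidelity (gaussian r) coherent :=
  (lintegral_heterodyne_gaussian hr).ge.trans (lintegral_heterodyne_le_classicalFidelity _ _)

end CoherentTeleportation

end

theorem mainTheorem5 :
    (∀ (p : Measure ℂ) [IsProbabilityMeasure p], CoherentTeleportation.PhaseInvariant p →
      CoherentTeleportation.classicalFidelity p CoherentTeleportation.coherent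
          ≤ (⨅ q : PMF ℕ, CoherentTeleportation.benchmark p (fun k => q k)) ∧
      (⨅ q : PMF ℕ, CoherentTeleportation.benchmark p (fun k => q k))
          ≤ CoherentTeleportation.benchmark p
              (fun k => ENNReal.ofReal (CoherentTeleportation.nu p k))) ∧
    (∀ r : ℝ, 0 < r →
      IsProbabilityMeasure (CoherentTeleportation.gaussian r) ∧
      CoherentTeleportation.PhaseInvariant (CoherentTeleportation.gaussian r) ∧
      CoherentTeleportation.classicalFidelity (CoherentTeleportation.gaussian r)
          CoherentTeleportation.coherent = ENNReal.ofReal ((1 + r) / (2 + r)) ∧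
      (⨅ q : PMF ℕ, CoherentTeleportation.benchmark (CoherentTeleportation.gaussian r)
          (fun k => q k)) = ENNReal.ofReal ((1 + r) / (2 + r)) ∧
      CoherentTeleportation.benchmark (CoherentTeleportation.gaussian r)
          (fun k => ENNReal.ofReal (CoherentTeleportation.nu (CoherentTeleportation.gaussian r) k))
        = ENNReal.ofReal ((1 + r) / (2 + r))) := by
  refine ⟨fun p _ hp => ⟨le_iInf fun q =>
    CoherentTeleportation.classicalFidelity_le_benchmark p hp q,
    CoherentTeleportation.iInf_benchmark_le p⟩, fun r hr => ?_⟩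
  have hprob := CoherentTeleportation.isProbabilityMeasure_gaussian hr
  have hphase := CoherentTeleportation.phaseInvariant_gaussian r
  have hbench := CoherentTeleportation.benchmark_gaussian hr
  have hlower := CoherentTeleportation.le_classicalFidelity_gaussian hr
  have hfid : CoherentTeleportation.classicalFidelity (CoherentTeleportation.gaussian r)
      CoherentTeleportation.coherent ≤
      ⨅ q : PMF ℕ, CoherentTeleportation.benchmark (CoherentTeleportation.gaussian r)
        (fun k => q k) := le_iInf fun q =>
    CoherentTeleportation.classicalFidelity_le_benchmark _ hphase q
  have hinf := (CoherentTeleportation.iInf_benchmark_le (CoherentTeleportation.gaussian r)).trans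
    hbench.le
  -- The chain `(1+r)/(2+r) ≤ F ≤ inf_q ≤ benchmark(ν) = (1+r)/(2+r)` closes, forcing equality
  -- throughout.
  exact ⟨hprob, hphase, le_antisymm (hfid.trans hinf) hlower,
    le_antisymm hinf (hlower.trans hfid), hbench⟩
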